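/- **Instance.** Customers $1,\dots,n$ ($n\ge 0$) are named in the order of a given tour, $0$ is the depot. Given are real numbers $c_{i,j}\ge 0$ (travel costs, $0\le i,j\le n$), $d_i,p_i\ge 0$ (delivery and pickup quantities, $1\le i\le n$), a capacity $Q\ge0$ and a penalty factor $\alpha\ge 0$. For $0\le i\le j\le k\le n$ put $$load(i,j,k)=\sum_{z=i+1}^{j}p_z+\sum_{z=j+1}^{k}d_z ,$$ and let $highest(i,k)$ be the index $z\in\{i,\dots,k\}$ that maximizes $load(i,z,k)$, the largest one in case of ties. On the nodes $0_0,\dots,0_n$ with all arcs $(0_i,0_j)$, $i<j$, let the arc $(0_i,0_j)$, which stands for the route $0,i+1,\dots,j,0$, have weight $c_{\alpha h}(i,j)=c(i,j)+pen_{\alpha h}(i,j)$, where $$c(i,j)=c_{0,i+1}+\sum_{x=i+2}^{j}c_{x-1,x}+c_{j,0},\qquad pen_{\alpha h}(i,j)=\alpha\max\bigl(load(i,highest(i,j),j)-Q,\,0\bigr).$$ An optimal split is a shortest path from $0_0$ to $0_n$. An *optimal predecessor* of $0_x$ is the last node but one of some shortest path from $0_0$ to $0_x$. **Comparisons.** Let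 $C[i]=\sum_{z=1}^{i}c_{z-1,z}$, $D[i]=\sum_{z=1}^i d_z$, $P[i]=\sum_{z=1}^i p_z$, and, for an array $pot$, - $dominates(i,j)$: $pot[i]+c_{0,i+1}+C[j+1]-C[i+1]<pot[j]+c_{0,j+1}$; - $dominates_{\alpha p}(i,j)$: $pot[i]+c_{0,i+1}+C[j+1]-C[i+1]+\alpha(P[j]-P[i])<pot[j]+c_{0,j+1}$; - $dominates_h(i,j)$: $D[j]-D[i]>P[j]-P[i]$; - $pen_\alpha(i,j,x)=\alpha\max(P[j]-P[i]+D[x]-D[j]-Q,0)$ and $c_\alpha(i,j,x)=c_{0,i+1}+C[x]-C[i+1]+c_{x,0}+pen_\alpha(i,j,x)$; - $dominates_\alpha(i,j,k,l,x)$: $pot[i]+c_{0,i+1}+C[k+1]-C[i+1]+pen_\alpha(i,j,x)<pot[k]+c_{0,k+1}+pen_\alpha(k,l,x)$. **Algorithm.** $\Lambda$ is a double-ended queue with a cursor $best$ (possibly null); $prev$ and $next$ are the elements just in front of and just behind $best$. $\Lambda_h$ is a double-ended queue. First the prefix sums $C,D,P$ are computed in a loop, and $h[i]\leftarrow i$ for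 $0\le i\le n$. Then (indentation shows nesting): 1. $pot[0]\leftarrow0$; $\Lambda\leftarrow()$; $\Lambda.best\leftarrow null$; $\Lambda_h\leftarrow(0)$ 2. for $x=1$ to $n$: 3. $\quad$while $\Lambda$ is not empty and not $dominates(\Lambda.back,x-1)$: 4. $\qquad$if $\Lambda.best=\Lambda.back$: 5. $\qquad\quad\Lambda.best\leftarrow null$ 6. $\qquad\Lambda.remove\_back$ 7. $\quad\Lambda.insert\_back(x-1)$ 8. $\quad$if $\Lambda.best=null$: 9. $\qquad\Lambda.best\leftarrow\Lambda.back$ 10. $\qquad$while $\Lambda.prev$ exists and not $dominates_{\alpha p}(\Lambda.prev,\Lambda.best)$: 11. $\qquad\quad\Lambda.remove\_prev$ 12. $\quad$while $\Lambda_h$ is not empty and not $dominates_h(\Lambda_h.back,x)$: 13. $\qquad\Lambda_h.remove\_back$ 14. $\quad\Lambda_h.insert\_back(x)$ 15. $\quad$if not $dominates_h(h[\Lambda.best],x)$: 16. $\qquad h[\Lambda.best]\leftarrow x$ 17. $\qquad$while $\Lambda.prev$ exists and not $dominates_h(h[\Lambda.prev],x)$: 18. $\qquad\quad h[\Lambda.prev]\leftarrow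 x$; $\Lambda.move\_prev$; $\Lambda.remove\_next$ 19. $\qquad$if $\Lambda.prev$ exists and $dominates_\alpha(\Lambda.prev,h[\Lambda.prev],\Lambda.best,h[\Lambda.best],x)$: 20. $\qquad\quad\Lambda.move\_prev$; $\Lambda.remove\_next$ 21. $\quad$if $\Lambda.next$ exists: 22. $\qquad$while $\Lambda_h.front<\Lambda.next$: 23. $\qquad\quad\Lambda_h.remove\_front$ 24. $\quad$while $\Lambda.next$ exists and $pen_\alpha(\Lambda.next,\Lambda_h.front,x)>0$: 25. $\qquad$if $dominates_\alpha(\Lambda.best,h[\Lambda.best],\Lambda.next,\Lambda_h.front,x)$: 26. $\qquad\quad\Lambda.remove\_next$ 27. $\qquad$else: 28. $\qquad\quad h[\Lambda.next]\leftarrow\Lambda_h.front$; $\Lambda.move\_next$ 29. $\qquad\quad$while $\Lambda.prev$ exists and not $dominates_{\alpha p}(\Lambda.prev,\Lambda.best)$: 30. $\qquad\qquad\Lambda.remove\_prev$ 31. $\qquad$if $\Lambda.next$ exists: 32. $\qquad\quad$while $\Lambda_h.front<\Lambda.next$: 33. $\qquad\qquad\Lambda_h.remove\_front$ 34. $\quad$if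 $\Lambda.next$ exists and not $dominates_\alpha(\Lambda.best,h[\Lambda.best],\Lambda.next,\Lambda_h.front,x)$: 35. $\qquad h[\Lambda.next]\leftarrow\Lambda_h.front$; $\Lambda.move\_next$ 36. $\qquad$while $\Lambda.prev$ exists and not $dominates_{\alpha p}(\Lambda.prev,\Lambda.best)$: 37. $\qquad\quad\Lambda.remove\_prev$ 38. $\quad pot[x]\leftarrow pot[\Lambda.best]+c_\alpha(\Lambda.best,h[\Lambda.best],x)$; $pred[x]\leftarrow\Lambda.best$ The execution of one line is one step; it consists of a bounded number of real-number operations and comparisons, array accesses and deque operations. **Claim.** Each iteration $x=1,\dots,n$ reaches line 38 exactly once. At that moment $pot[i]$ is the length of a shortest path from $0_0$ to $0_i$ for each $i<x$, the elements of $\Lambda=(i_1,\dots,i_m)$ are smaller than $x$, the cursor points to some element $i_l$ of $\Lambda$, and the following hold. (a) For $1\le j<m$: $i_j<i_{j+1}$. (b) For $1\le j<m$: $dominates(i_j,i_{j+1})$. (c) For $l<j\le m$: $pen_{\alpha h}(i_j,x)=0$. (d) If $l<m$: $dominates_\alpha(i_l,highest(i_l,x),i_{l+1},highest(i_{l+1},x),x)$.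 (e) For $1\le j<l$: $pen_{\alpha h}(i_j,x)>0$. (f) For $1\le j<l$: not $dominates_\alpha(i_j,highest(i_j,x),i_{j+1},highest(i_{j+1},x),x)$. (g) For $1\le j<l$: $dominates_{\alpha p}(i_j,i_{j+1})$. Moreover, for every $i<x$ that is no longer in $\Lambda$ and every $y$ with $x\le y\le n$ there is $j\in\Lambda$ with $pot[j]+c_{\alpha h}(j,y)\le pot[i]+c_{\alpha h}(i,y)$; and $0_{\Lambda.best}$ is an optimal predecessor of $0_x$. The algorithm terminates. At the end, $pot[x]$ is the length of a shortest path from $0_0$ to $0_x$ for all $0\le x\le n$, and $0_{pred[x]}$ is an optimal predecessor of $0_x$ for all $1\le x\le n$. Some shortest path from $0_0$ to $0_n$ (an optimal split) has $pred[y]=i$ for each of its arcs $(0_i,0_y)$, and it contains no arc $(0_i,0_y)$ for which $i$ has been removed from $\Lambda$ by line 38 of some iteration $x$ with $i<x\le y$. The running time is $\Theta(n)$: there are constants $a,b>0$, independent of the instance, such that for $n\ge1$ the number of steps, including those for the prefix sums, lies between $an$ and $bn$ for every instance with $n$ customers. -/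

import Mathlib

namespace SoftVRPSPD

/-- An instance of the soft VRPSPD with a giant tour, the `n` customers being named `1, …, n` in tour
order and `0` being the depot: travel costs `c`, delivery and pickup quantities `d`, `p`, vehicle
capacity `Q` and penalty factor `α`. Values at indices outside `0, …, n` are never used. -/
structure Instance (K : Type) [CommRing K] [LinearOrder K] (n : ℕ) where
  c : ℕ → ℕ → K
  d : ℕ → K
  p : ℕ → K
  Q : K
  α : K
  c_nonneg : ∀ i j, i ≤ n → j ≤ n → 0 ≤ c i j
  d_nonneg : ∀ i, 1 ≤ i → i ≤ n → 0 ≤ d i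
  p_nonneg : ∀ i, 1 ≤ i → i ≤ n → 0 ≤ p i
  Q_nonneg : 0 ≤ Q
  α_nonneg : 0 ≤ α

/-! ### The auxiliary graph: nodes `0, …, n` (copies of the depot), an arc `(i, j)` for all `i < j` -/

section Graph

variable {K : Type} [CommRing K] [LinearOrder K] {n : ℕ}

/-- Cost of the route `depot, i+1, i+2, …, j, depot` (for `i < j`). -/
def Instance.routeCost (I : Instance K n) (i j : ℕ) : K :=
  I.c 0 (i + 1) + ∑ x ∈ Finset.Ico (i + 1) j, I.c x (x + 1) + I.c j 0

/-- Load of the vehicle on the route serving `i+1, …, k`, just after customer `j`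
(for `j = i`: when leaving the depot). -/
def Instance.load (I : Instance K n) (i j k : ℕ) : K :=
  ∑ z ∈ Finset.Ioc i j, I.p z + ∑ z ∈ Finset.Ioc j k, I.d z

/-- The place `z ∈ {i, …, k}` of highest load on the route serving `i+1, …, k`; among several
such places the last one. -/
def Instance.highest (I : Instance K n) (i k : ℕ) : ℕ :=
  Nat.findGreatest (fun z => i ≤ z ∧ ∀ w ∈ Finset.Icc i k, I.load i w k ≤ I.load i z k) k

/-- Linear penalty of the route serving `i+1, …, j`. -/
def Instance.pen (I : Instance K n) (i j : ℕ) : K :=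
  I.α * max (I.load i (I.highest i j) j - I.Q) 0

/-- Weight of the arc `(i, j)`. -/
def Instance.arcCost (I : Instance K n) (i j : ℕ) : K :=
  I.routeCost i j + I.pen i j

/-- `ℓ` is the node list of a path from node `0` to node `x`. -/
def IsPath (x : ℕ) (ℓ : List ℕ) : Prop :=
  ℓ.head? = some 0 ∧ ℓ.getLast? = some x ∧ ℓ.IsChain (· < ·)

/-- Total weight of the arcs of a path. -/
def Instance.pathCost (I : Instance K n) : List ℕ → K
  | i :: j :: t => I.arcCost i j + I.pathCost (j :: t)
  | _ => 0

def Instance.IsShortestPath (I : Instance K n) (x : ℕ) (ℓ : List ℕ) : Prop :=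
  IsPath x ℓ ∧ ∀ ℓ', IsPath x ℓ' → I.pathCost ℓ ≤ I.pathCost ℓ'

/-- `v` is the length of a shortest path from `0` to `x`. -/
def Instance.IsDist (I : Instance K n) (x : ℕ) (v : K) : Prop :=
  ∃ ℓ, I.IsShortestPath x ℓ ∧ I.pathCost ℓ = v

/-- Some shortest path from `0` to `x` has `(i, x)` as its last arc. -/
def Instance.IsOptimalPred (I : Instance K n) (i x : ℕ) : Prop :=
  ∃ ℓ, IsPath i ℓ ∧ I.IsShortestPath x (ℓ ++ [x])

end Graph

/-! ### The comparisons made by the algorithm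

They only look up the cumulative costs, deliveries and pickups `C`, `D`, `P` and the array `pot`. -/

/-- Tables of prefix sums. -/
structure Tables (K : Type) where
  C : ℕ → K
  D : ℕ → K
  P : ℕ → K

section Comparisons

variable {K : Type} [CommRing K] [LinearOrder K] {n : ℕ}

/-- The tables that belong to the instance. -/
def Instance.tables (I : Instance K n) : Tables K where
  C i := ∑ z ∈ Finset.range i, I.c z (z + 1)
  D i := ∑ z ∈ Finset.Icc 1 i, I.d z
  P i := ∑ z ∈ Finset.Icc 1 i, I.p z

def Instance.dominates (I : Instance K n) (tb : Tables K) (pot : ℕ → K) (i j : ℕ) : Prop :=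
  pot i + I.c 0 (i + 1) + tb.C (j + 1) - tb.C (i + 1) < pot j + I.c 0 (j + 1)

def dominatesH (tb : Tables K) (i j : ℕ) : Prop :=
  tb.D j - tb.D i > tb.P j - tb.P i

/-- Penalty of the route serving `i+1, …, x`, provided that `j` is a place of highest load. -/
def Instance.penAt (I : Instance K n) (tb : Tables K) (i j x : ℕ) : K :=
  I.α * max (tb.P j - tb.P i + tb.D x - tb.D j - I.Q) 0

def Instance.dominatesP (I : Instance K n) (tb : Tables K) (pot : ℕ → K) (i j : ℕ) : Prop :=
  pot i + I.c 0 (i + 1) + tb.C (j + 1) - tb.C (i + 1) + I.α * (tb.P j - tb.P i)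
    < pot j + I.c 0 (j + 1)

def Instance.dominatesA (I : Instance K n) (tb : Tables K) (pot : ℕ → K) (i j k l x : ℕ) : Prop :=
  pot i + I.c 0 (i + 1) + tb.C (k + 1) - tb.C (i + 1) + I.penAt tb i j x
    < pot k + I.c 0 (k + 1) + I.penAt tb k l x

/-- Weight of the arc `(i, x)`, provided that `j` is a place of highest load. -/
def Instance.costAt (I : Instance K n) (tb : Tables K) (i j x : ℕ) : K :=
  I.c 0 (i + 1) + tb.C x - tb.C (i + 1) + I.c x 0 + I.penAt tb i j x

instance (I : Instance K n) (tb : Tables K) (pot : ℕ → K) (i j : ℕ) :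
    Decidable (I.dominates tb pot i j) := by
  unfold Instance.dominates; infer_instance

instance (tb : Tables K) (i j : ℕ) : Decidable (dominatesH tb i j) := by
  unfold dominatesH; infer_instance

instance (I : Instance K n) (tb : Tables K) (pot : ℕ → K) (i j : ℕ) :
    Decidable (I.dominatesP tb pot i j) := by
  unfold Instance.dominatesP; infer_instance

instance (I : Instance K n) (tb : Tables K) (pot : ℕ → K) (i j k l x : ℕ) :
    Decidable (I.dominatesA tb pot i j k l x) := by
  unfold Instance.dominatesA; infer_instance

end Comparisons

/-! ### Double-ended queue with a movable cursor -/

/-- The elements from front to back, and the position (counted from `0`) of the cursor `best`;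
`none` if the cursor is null. -/
structure CursorDeque where
  items : List ℕ
  cur : Option ℕ

namespace CursorDeque

def back? (L : CursorDeque) : Option ℕ := L.items.getLast?

def best? (L : CursorDeque) : Option ℕ := L.cur.bind fun k => L.items[k]?

/-- The element just in front of the cursor. -/
def prev? (L : CursorDeque) : Option ℕ :=
  match L.cur with
  | some (k + 1) => L.items[k]?
  | _ => none

/-- The element just behind the cursor. -/
def next? (L : CursorDeque) : Option ℕ := L.cur.bind fun k => L.items[k + 1]?

def insertBack (L : CursorDeque) (a : ℕ) : CursorDeque := { L with items := L.items ++ [a] }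

def removeBack (L : CursorDeque) : CursorDeque := { L with items := L.items.dropLast }

def removePrev (L : CursorDeque) : CursorDeque :=
  match L.cur with
  | some (k + 1) => ⟨L.items.eraseIdx k, some k⟩
  | _ => L

def removeNext (L : CursorDeque) : CursorDeque :=
  match L.cur with
  | some k => ⟨L.items.eraseIdx (k + 1), some k⟩
  | none => L

def movePrev (L : CursorDeque) : CursorDeque := { L with cur := L.cur.map (· - 1) }

def moveNext (L : CursorDeque) : CursorDeque := { L with cur := L.cur.map (· + 1) }

def nullBest (L : CursorDeque) : CursorDeque := { L with cur := none }

def bestToBack (L : CursorDeque) : CursorDeque := { L with cur := some (L.items.length - 1) }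

end CursorDeque

/-! ### The algorithm, as a machine that executes one line of pseudocode per step

Every step performs a bounded number of arithmetic operations and comparisons of numbers, array
accesses, and operations on the two double-ended queues. -/

/-- Line labels of the pseudocode (line 27 is a bare `else`), preceded by the computation of the
prefix sums. -/
inductive Line
  | pre
  | l1 | l2 | l3 | l4 | l5 | l6 | l7 | l8 | l9 | l10 | l11 | l12 | l13 | l14 | l15 | l16 | l17 | l18
  | l19 | l20 | l21 | l22 | l23 | l24 | l25 | l26 | l28 | l29 | l30 | l31 | l32 | l33 | l34 | l35
  | l36 | l37 | l38
  | done

/-- Memory of the machine: the line to be executed next, the loop counter `x`, the queue of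
predecessors, the queue of candidates for the highest load (front to back), the arrays
`h`, `pot`, `pred`, and the tables of prefix sums. -/
structure State (K : Type) where
  line : Line
  x : ℕ
  queue : CursorDeque
  queueH : List ℕ
  h : ℕ → ℕ
  pot : ℕ → K
  pred : ℕ → ℕ
  tables : Tables K

section Machine

variable {K : Type} [CommRing K] [LinearOrder K] {n : ℕ}

/-- Empty memory. -/
def State.init (K : Type) [CommRing K] : State K where
  line := .pre
  x := 0
  queue := ⟨[], none⟩
  queueH := []
  h := fun _ => 0
  pot := fun _ => 0
  pred := fun _ => 0
  tables := ⟨fun _ => 0, fun _ => 0, fun _ => 0⟩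

/-- Execution of one line. The result is `none` if the machine has finished or if an element
of a queue is accessed that does not exist. -/
def Instance.step (I : Instance K n) (s : State K) : Option (State K) :=
  match s.line with
  -- `for i = 1 to n: C[i] ← C[i-1] + c(i-1,i); D[i] ← D[i-1] + d(i); P[i] ← P[i-1] + p(i); h[i] ← i`
  | .pre =>
    if s.x < n then
      some { s with
        x := s.x + 1
        tables :=
          ⟨Function.update s.tables.C (s.x + 1) (s.tables.C s.x + I.c s.x (s.x + 1)),
           Function.update s.tables.D (s.x + 1) (s.tables.D s.x + I.d (s.x + 1)),
           Function.update s.tables.P (s.x + 1) (s.tables.P s.x + I.p (s.x + 1))⟩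
        h := Function.update s.h (s.x + 1) (s.x + 1) }
    else some { s with line := .l1 }
  -- `pot[0] ← 0; Λ ← (); Λ.best ← null; Λh ← (0)`
  | .l1 => some { s with
      line := .l2, x := 0, pot := Function.update s.pot 0 0, queue := ⟨[], none⟩, queueH := [0] }
  -- `for x = 1 to n`
  | .l2 =>
    if s.x < n then some { s with line := .l3, x := s.x + 1 } else some { s with line := .done }
  -- `while Λ.not_empty and not dominates(Λ.back, x-1)`
  | .l3 =>
    match s.queue.back? with
    | some b =>
      if I.dominates s.tables s.pot b (s.x - 1) then some { s with line := .l7 }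
      else some { s with line := .l4 }
    | none => some { s with line := .l7 }
  -- `if Λ.best == Λ.back`
  | .l4 =>
    if s.queue.best? = s.queue.back? then some { s with line := .l5 }
    else some { s with line := .l6 }
  | .l5 => some { s with line := .l6, queue := s.queue.nullBest }
  | .l6 => some { s with line := .l3, queue := s.queue.removeBack }
  | .l7 => some { s with line := .l8, queue := s.queue.insertBack (s.x - 1) }
  -- `if Λ.best == null`
  | .l8 => if s.queue.cur = none then some { s with line := .l9 } else some { s with line := .l12 }
  | .l9 => some { s with line := .l10, queue := s.queue.bestToBack }
  -- `while Λ.has_prev and not dominates_αp(Λ.prev, Λ.best)`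
  | .l10 =>
    match s.queue.prev? with
    | some a => do
      let b ← s.queue.best?
      if I.dominatesP s.tables s.pot a b then some { s with line := .l12 }
      else some { s with line := .l11 }
    | none => some { s with line := .l12 }
  | .l11 => some { s with line := .l10, queue := s.queue.removePrev }
  -- `while Λh.not_empty and not dominates_h(Λh.back, x)`
  | .l12 =>
    match s.queueH.getLast? with
    | some b =>
      if dominatesH s.tables b s.x then some { s with line := .l14 }
      else some { s with line := .l13 }
    | none => some { s with line := .l14 }
  | .l13 => some { s with line := .l12, queueH := s.queueH.dropLast }
  | .l14 => some { s with line := .l15, queueH := s.queueH ++ [s.x] }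
  -- `if not dominates_h(h[Λ.best], x)`
  | .l15 => do
    let b ← s.queue.best?
    if dominatesH s.tables (s.h b) s.x then some { s with line := .l21 }
    else some { s with line := .l16 }
  | .l16 => do
    let b ← s.queue.best?
    some { s with line := .l17, h := Function.update s.h b s.x }
  -- `while Λ.has_prev and not dominates_h(h[Λ.prev], x)`
  | .l17 =>
    match s.queue.prev? with
    | some a =>
      if dominatesH s.tables (s.h a) s.x then some { s with line := .l19 }
      else some { s with line := .l18 }
    | none => some { s with line := .l19 }
  -- `h[Λ.prev] ← x; Λ.move_prev; Λ.remove_next`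
  | .l18 => do
    let a ← s.queue.prev?
    some { s with
      line := .l17, h := Function.update s.h a s.x, queue := s.queue.movePrev.removeNext }
  -- `if Λ.has_prev and dominates_α(Λ.prev, h[Λ.prev], Λ.best, h[Λ.best], x)`
  | .l19 =>
    match s.queue.prev? with
    | some a => do
      let b ← s.queue.best?
      if I.dominatesA s.tables s.pot a (s.h a) b (s.h b) s.x then some { s with line := .l20 }
      else some { s with line := .l21 }
    | none => some { s with line := .l21 }
  | .l20 => some { s with line := .l21, queue := s.queue.movePrev.removeNext }
  -- `if Λ.has_next`
  | .l21 =>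
    if s.queue.next?.isSome then some { s with line := .l22 } else some { s with line := .l24 }
  -- `while Λh.front < Λ.next`
  | .l22 => do
    let f ← s.queueH.head?
    let a ← s.queue.next?
    if f < a then some { s with line := .l23 } else some { s with line := .l24 }
  | .l23 => some { s with line := .l22, queueH := s.queueH.tail }
  -- `while Λ.has_next and pen_α(Λ.next, Λh.front, x) > 0`
  | .l24 =>
    match s.queue.next? with
    | some a => do
      let f ← s.queueH.head?
      if I.penAt s.tables a f s.x > 0 then some { s with line := .l25 }
      else some { s with line := .l34 }
    | none => some { s with line := .l34 }
  -- `if dominates_α(Λ.best, h[Λ.best], Λ.next, Λh.front, x)`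
  | .l25 => do
    let b ← s.queue.best?
    let a ← s.queue.next?
    let f ← s.queueH.head?
    if I.dominatesA s.tables s.pot b (s.h b) a f s.x then some { s with line := .l26 }
    else some { s with line := .l28 }
  | .l26 => some { s with line := .l31, queue := s.queue.removeNext }
  -- `h[Λ.next] ← Λh.front; Λ.move_next`
  | .l28 => do
    let a ← s.queue.next?
    let f ← s.queueH.head?
    some { s with line := .l29, h := Function.update s.h a f, queue := s.queue.moveNext }
  -- `while Λ.has_prev and not dominates_αp(Λ.prev, Λ.best)`
  | .l29 =>
    match s.queue.prev? with
    | some a => do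
      let b ← s.queue.best?
      if I.dominatesP s.tables s.pot a b then some { s with line := .l31 }
      else some { s with line := .l30 }
    | none => some { s with line := .l31 }
  | .l30 => some { s with line := .l29, queue := s.queue.removePrev }
  -- `if Λ.has_next`
  | .l31 =>
    if s.queue.next?.isSome then some { s with line := .l32 } else some { s with line := .l24 }
  -- `while Λh.front < Λ.next`
  | .l32 => do
    let f ← s.queueH.head?
    let a ← s.queue.next?
    if f < a then some { s with line := .l33 } else some { s with line := .l24 }
  | .l33 => some { s with line := .l32, queueH := s.queueH.tail }
  -- `if Λ.has_next and not dominates_α(Λ.best, h[Λ.best], Λ.next, Λh.front, x)`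
  | .l34 =>
    match s.queue.next? with
    | some a => do
      let b ← s.queue.best?
      let f ← s.queueH.head?
      if I.dominatesA s.tables s.pot b (s.h b) a f s.x then some { s with line := .l38 }
      else some { s with line := .l35 }
    | none => some { s with line := .l38 }
  -- `h[Λ.next] ← Λh.front; Λ.move_next`
  | .l35 => do
    let a ← s.queue.next?
    let f ← s.queueH.head?
    some { s with line := .l36, h := Function.update s.h a f, queue := s.queue.moveNext }
  -- `while Λ.has_prev and not dominates_αp(Λ.prev, Λ.best)`
  | .l36 =>
    match s.queue.prev? with
    | some a => do
      let b ← s.queue.best?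
      if I.dominatesP s.tables s.pot a b then some { s with line := .l38 }
      else some { s with line := .l37 }
    | none => some { s with line := .l38 }
  | .l37 => some { s with line := .l36, queue := s.queue.removePrev }
  -- `pot[x] ← pot[Λ.best] + c_α(Λ.best, h[Λ.best], x); pred[x] ← Λ.best`
  | .l38 => do
    let b ← s.queue.best?
    some { s with
      line := .l2
      pot := Function.update s.pot s.x (s.pot b + I.costAt s.tables b (s.h b) s.x)
      pred := Function.update s.pred s.x b }
  | .done => none

/-- The memory after `t` steps (`none` if the machine has stopped earlier). -/
def Instance.run (I : Instance K n) : ℕ → Option (State K)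
  | 0 => some (State.init K)
  | t + 1 => (I.run t).bind I.step

/-- After `t` steps the machine is about to execute line 38 and its memory is `s`; the iteration
is `s.x`. -/
def Instance.AtLine38 (I : Instance K n) (t : ℕ) (s : State K) : Prop :=
  I.run t = some s ∧ s.line = .l38

/-- The seven conditions on the queue `Λ = (i_1, …, i_m)` with cursor `Λ.best = i_l`, in
iteration `x`; here positions are counted from `0`. -/
structure Instance.Sorted (I : Instance K n) (pot : ℕ → K) (L : CursorDeque) (x l : ℕ) : Prop where
  cursor : L.cur = some l ∧ l < L.items.length
  index_sorted : ∀ k i j, L.items[k]? = some i → L.items[k + 1]? = some j → i < j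
  better_nonpenalized : ∀ k i j, L.items[k]? = some i → L.items[k + 1]? = some j →
    I.dominates I.tables pot i j
  right_not_penalized : ∀ k i, l < k → L.items[k]? = some i → I.pen i x = 0
  better_than_right : ∀ i j, L.items[l]? = some i → L.items[l + 1]? = some j →
    I.dominatesA I.tables pot i (I.highest i x) j (I.highest j x) x
  left_penalized : ∀ k i, k < l → L.items[k]? = some i → 0 < I.pen i x
  left_not_better : ∀ k i j, k < l → L.items[k]? = some i → L.items[k + 1]? = some j →
    ¬ I.dominatesA I.tables pot i (I.highest i x) j (I.highest j x) x
  left_perm_better : ∀ k i j, k < l → L.items[k]? = some i → L.items[k + 1]? = some j →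
    I.dominatesP I.tables pot i j

end Machine

end SoftVRPSPD

/-! Up to a summand that depends only on `x`, the predecessor `i` of `x` has the value `val i x =
key i + pen i x`. Everything therefore rests on how the gap `pen i y - pen j y`, for `i < j`, varies
with `y`.

By `load_eq` the place of highest load on a route is the last minimizer of `net` on its range of
indices. So an earlier start has the higher peak load, and the gap between two peaks never grows
with the endpoint (`peak_sub_anti`). The penalty is zero up to the capacity and linear beyond it.
Hence the penalty gap moves in favour of `j` as long as `j` pays nothing, and in favour of `i` once
`j` pays, but then it never falls below `α * (P j - P i)`. This gives the four lemmas
`supersedes_of_...`, criteria for discarding one of two candidates for all later nodes. Every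
removal made by the algorithm is an instance of one of them.

The invariant `Queue` says that every candidate is superseded by an element of the queue. Elements
in front of the cursor pay a penalty and are at present no better than the cursor, but would be
better under a permanent penalty; keys increase along the queue. Once the elements behind the cursor
pay nothing and the first of them is worse than the cursor, the cursor is best among all
predecessors (`Settled.val_le`), and `pot` follows the recursion of `minDist`. The array `h` and the
records of `net` in `queueH` supply the places of highest load.

For the running time, `State.credit` is a potential that pays for all but a bounded number of steps
per iteration; the prefix sums alone give the lower bound. The monotone quantity `State.rank` makes
the visit to `l38` unique for each `x`. Finally, a removed element never returns to the queue, so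
the path that follows `pred` uses no arc from a node already removed. -/

namespace SoftVRPSPD

namespace Instance

/-! ### Places of highest load, and penalty gaps between two starting points. -/

section Penalty

variable {n : ℕ} (I : Instance ℝ n)

/-- Cumulative delivery minus cumulative pickup; places of highest load minimize it. -/
noncomputable def net (i : ℕ) : ℝ := I.tables.D i - I.tables.P i

theorem sum_Ioc_eq_sub (f : ℕ → ℝ) {i j : ℕ} (h : i ≤ j) :
    ∑ z ∈ Finset.Ioc i j, f z = ∑ z ∈ Finset.Icc 1 j, f z - ∑ z ∈ Finset.Icc 1 i, f z := by
  have key : ∀ k, Finset.Icc 1 k = Finset.Ioc 0 k := fun k => by ext; simp [Nat.succ_le_iff]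
  rw [key, key, eq_sub_iff_add_eq, add_comm, Finset.sum_Ioc_consecutive _ (Nat.zero_le i) h]

/-- The place `j` enters only through `net j`, so maximizing the load over `j` means minimizing
`net`, whatever the ends of the route are. -/
theorem load_eq {i j k : ℕ} (hij : i ≤ j) (hjk : j ≤ k) :
    I.load i j k = I.tables.D k - I.tables.P i - I.net j := by
  simp only [load, net, tables, sum_Ioc_eq_sub _ hij, sum_Ioc_eq_sub _ hjk]
  ring

theorem monotone_P {i j : ℕ} (h : i ≤ j) (hj : j ≤ n) : I.tables.P i ≤ I.tables.P j := by
  have := sum_Ioc_eq_sub I.p h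
  have h0 : 0 ≤ ∑ z ∈ Finset.Ioc i j, I.p z := Finset.sum_nonneg fun z hz => by
    rw [Finset.mem_Ioc] at hz
    exact I.p_nonneg z (by omega) (by omega)
  simp only [tables]
  linarith

theorem monotone_D {i j : ℕ} (h : i ≤ j) (hj : j ≤ n) : I.tables.D i ≤ I.tables.D j := by
  have := sum_Ioc_eq_sub I.d h
  have h0 : 0 ≤ ∑ z ∈ Finset.Ioc i j, I.d z := Finset.sum_nonneg fun z hz => by
    rw [Finset.mem_Ioc] at hz
    exact I.d_nonneg z (by omega) (by omega)
  simp only [tables]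
  linarith

theorem exists_last_argmin (f : ℕ → ℝ) {i k : ℕ} (h : i ≤ k) :
    ∃ z, i ≤ z ∧ z ≤ k ∧ (∀ w, i ≤ w → w ≤ k → f z ≤ f w) ∧ ∀ w, z < w → w ≤ k → f z < f w := by
  induction k, h using Nat.le_induction with
  | base =>
    refine ⟨i, le_rfl, le_rfl, fun w h1 h2 => ?_, fun w h1 h2 => by omega⟩
    rw [le_antisymm h2 h1]
  | succ k hk ih =>
    obtain ⟨z, h1, h2, h3, h4⟩ := ih
    rcases lt_or_ge (f z) (f (k + 1)) with hlt | hge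
    · refine ⟨z, h1, by omega, fun w hw hw' => ?_, fun w hw hw' => ?_⟩ <;>
        rcases Nat.lt_or_ge k w with hk' | hk'
      · obtain rfl : w = k + 1 := by omega
        exact hlt.le
      · exact h3 w hw hk'
      · obtain rfl : w = k + 1 := by omega
        exact hlt
      · exact h4 w hw hk'
    · refine ⟨k + 1, by omega, le_rfl, fun w hw hw' => ?_, fun w hw hw' => by omega⟩
      rcases Nat.lt_or_ge k w with hk' | hk'
      · obtain rfl : w = k + 1 := by omega
        exact le_rfl
      · exact hge.trans (h3 w hw hk')

theorem highest_eq {i k z : ℕ} (hiz : i ≤ z) (hzk : z ≤ k)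
    (hmin : ∀ w, i ≤ w → w ≤ k → I.net z ≤ I.net w) (hlast : ∀ w, z < w → w ≤ k → I.net z < I.net w) :
    I.highest i k = z := by
  unfold highest
  rw [Nat.findGreatest_eq_iff]
  refine ⟨hzk, fun _ => ⟨hiz, fun w hw => ?_⟩, fun w hw hwk hP => ?_⟩
  · rw [Finset.mem_Icc] at hw
    rw [I.load_eq hw.1 hw.2, I.load_eq hiz hzk]
    linarith [hmin w hw.1 hw.2]
  · have := hP.2 z (Finset.mem_Icc.2 ⟨hiz, hzk⟩)
    rw [I.load_eq hiz hzk, I.load_eq hP.1 hwk] at this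
    linarith [hlast w hw hwk]

theorem highest_spec {i k : ℕ} (h : i ≤ k) : i ≤ I.highest i k ∧ I.highest i k ≤ k ∧
    (∀ w, i ≤ w → w ≤ k → I.net (I.highest i k) ≤ I.net w) ∧
    ∀ w, I.highest i k < w → w ≤ k → I.net (I.highest i k) < I.net w := by
  obtain ⟨z, h1, h2, h3, h4⟩ := exists_last_argmin I.net h
  rw [I.highest_eq h1 h2 h3 h4]
  exact ⟨h1, h2, h3, h4⟩

theorem highest_self (i : ℕ) : I.highest i i = i :=
  le_antisymm (I.highest_spec le_rfl).2.1 (I.highest_spec le_rfl).1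

/-- Together with `highest_succ_of_not_lt` this is the update rule for `h`: the last minimizer
stays, or it jumps to the new endpoint, which wins ties. One comparison decides. -/
theorem highest_succ_of_lt {i k : ℕ} (h : i ≤ k) (hlt : I.net (I.highest i k) < I.net (k + 1)) :
    I.highest i (k + 1) = I.highest i k := by
  obtain ⟨h1, h2, h3, h4⟩ := I.highest_spec h
  refine I.highest_eq h1 (by omega) (fun w hw hw' => ?_) (fun w hw hw' => ?_) <;>
    rcases Nat.lt_or_ge k w with hk' | hk'
  · obtain rfl : w = k + 1 := by omega
    exact hlt.le
  · exact h3 w hw hk'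
  · obtain rfl : w = k + 1 := by omega
    exact hlt
  · exact h4 w hw hk'

theorem highest_succ_of_not_lt {i k : ℕ} (h : i ≤ k)
    (hlt : ¬ I.net (I.highest i k) < I.net (k + 1)) : I.highest i (k + 1) = k + 1 := by
  obtain ⟨h1, h2, h3, h4⟩ := I.highest_spec h
  refine I.highest_eq (by omega) le_rfl (fun w hw hw' => ?_) (fun w hw hw' => by omega)
  rcases Nat.lt_or_ge k w with hk' | hk'
  · obtain rfl : w = k + 1 := by omega
    exact le_rfl
  · exact (not_lt.1 hlt).trans (h3 w hw hk')

/-- Highest load on the route serving `i+1, …, k`. -/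
noncomputable def peak (i k : ℕ) : ℝ := I.tables.D k - I.tables.P i - I.net (I.highest i k)

theorem pen_eq {i k : ℕ} (h : i ≤ k) : I.pen i k = I.α * max (I.peak i k - I.Q) 0 := by
  obtain ⟨h1, h2, -⟩ := I.highest_spec h
  rw [pen, I.load_eq h1 h2, peak]

theorem net_highest_anti_right {i x y : ℕ} (h : i ≤ x) (hxy : x ≤ y) :
    I.net (I.highest i y) ≤ I.net (I.highest i x) := by
  obtain ⟨h1, h2, -⟩ := I.highest_spec h
  exact (I.highest_spec (h.trans hxy)).2.2.1 _ h1 (h2.trans hxy)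

theorem net_highest_mono_left {i j x : ℕ} (hij : i ≤ j) (h : j ≤ x) :
    I.net (I.highest i x) ≤ I.net (I.highest j x) := by
  obtain ⟨h1, h2, -⟩ := I.highest_spec h
  exact (I.highest_spec (hij.trans h)).2.2.1 _ (hij.trans h1) h2

theorem peak_mono_right {i x y : ℕ} (h : i ≤ x) (hxy : x ≤ y) (hy : y ≤ n) :
    I.peak i x ≤ I.peak i y := by
  have := I.net_highest_anti_right h hxy
  have := I.monotone_D hxy hy
  simp only [peak]
  linarith

theorem peak_anti_left {i j x : ℕ} (hij : i ≤ j) (h : j ≤ x) (hx : x ≤ n) :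
    I.peak j x ≤ I.peak i x := by
  have := I.net_highest_mono_left hij h
  have := I.monotone_P hij (h.trans hx)
  simp only [peak]
  linarith

/-- The gap is `P j - P i` plus the difference of the two minima of `net`. If the minimizer for `i`
lies beyond `x`, then it is available to `j` as well and the gap has its least possible value `P j -
P i`. Otherwise the minimum for `i` has not changed since `x`, while that for `j` can only have
fallen. -/
theorem peak_sub_anti {i j x y : ℕ} (hij : i ≤ j) (h : j ≤ x) (hxy : x ≤ y) :
    I.peak i y - I.peak j y ≤ I.peak i x - I.peak j x := by
  have h1 := I.net_highest_anti_right h hxy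
  have h2 := I.net_highest_mono_left hij h
  obtain ⟨s1, s2, s3, -⟩ := I.highest_spec (hij.trans (h.trans hxy))
  simp only [peak]
  rcases Nat.lt_or_ge x (I.highest i y) with hlt | hge
  · have := (I.highest_spec (h.trans hxy)).2.2.1 _ (h.trans hlt.le) s2
    linarith
  · have := (I.highest_spec (hij.trans h)).2.2.1 _ s1 hge
    linarith

theorem pen_nonneg (i k : ℕ) : 0 ≤ I.pen i k :=
  mul_nonneg I.α_nonneg (le_max_right _ _)

theorem pen_self (i : ℕ) : I.pen i i = 0 := by
  rw [I.pen_eq le_rfl, peak, I.highest_self, net, max_eq_right (by linarith [I.Q_nonneg]), mul_zero]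

theorem pen_mono_right {i x y : ℕ} (h : i ≤ x) (hxy : x ≤ y) (hy : y ≤ n) :
    I.pen i x ≤ I.pen i y := by
  rw [I.pen_eq h, I.pen_eq (h.trans hxy)]
  have := I.peak_mono_right h hxy hy
  have := I.α_nonneg
  gcongr

theorem pen_anti_left {i j x : ℕ} (hij : i ≤ j) (h : j ≤ x) (hx : x ≤ n) :
    I.pen j x ≤ I.pen i x := by
  rw [I.pen_eq h, I.pen_eq (hij.trans h)]
  have := I.peak_anti_left hij h hx
  have := I.α_nonneg
  gcongr

theorem lt_peak_of_pen_pos {i x : ℕ} (h : i ≤ x) (hp : 0 < I.pen i x) : I.Q < I.peak i x := by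
  by_contra hc
  rw [I.pen_eq h, max_eq_right (by linarith), mul_zero] at hp
  exact lt_irrefl _ hp

theorem pen_eq_of_lt_peak {i x : ℕ} (h : i ≤ x) (hp : I.Q < I.peak i x) :
    I.pen i x = I.α * (I.peak i x - I.Q) := by
  rw [I.pen_eq h, max_eq_left (by linarith)]

/-- As long as the later start is free of penalty, the gap is just the penalty of the earlier one,
which increases with the endpoint. -/
theorem pen_sub_mono_of_pen_eq_zero {i j x y : ℕ} (hij : i ≤ j) (h : j ≤ x) (hxy : x ≤ y)
    (hy : y ≤ n) (h0 : I.pen j y = 0) : I.pen i x - I.pen j x ≤ I.pen i y - I.pen j y := by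
  linarith [I.pen_nonneg j x, I.pen_mono_right (hij.trans h) hxy hy]

/-- If `j` pays at `x`, then both pay from `x` on, so both penalties are linear in the peaks and
`peak_sub_anti` applies. -/
theorem pen_sub_anti_of_pen_pos {i j x y : ℕ} (hij : i ≤ j) (h : j ≤ x) (hxy : x ≤ y)
    (hy : y ≤ n) (h0 : 0 < I.pen j x) : I.pen i y - I.pen j y ≤ I.pen i x - I.pen j x := by
  have q := I.lt_peak_of_pen_pos h h0
  have a1 := I.peak_mono_right h hxy hy
  have a2 := I.peak_anti_left hij h (hxy.trans hy)
  have a3 := I.peak_anti_left hij (h.trans hxy) hy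
  rw [I.pen_eq_of_lt_peak h q, I.pen_eq_of_lt_peak (h.trans hxy) (by linarith),
    I.pen_eq_of_lt_peak (hij.trans h) (by linarith),
    I.pen_eq_of_lt_peak (hij.trans (h.trans hxy)) (by linarith)]
  have := mul_le_mul_of_nonneg_left (I.peak_sub_anti hij h hxy) I.α_nonneg
  linarith

/-- When both pay, the gap is `α` times the gap of the peaks, and the minimum of `net` over the
longer range is no larger. -/
theorem le_pen_sub_of_pen_pos {i j y : ℕ} (hij : i ≤ j) (h : j ≤ y) (hy : y ≤ n)
    (h0 : 0 < I.pen j y) : I.α * (I.tables.P j - I.tables.P i) ≤ I.pen i y - I.pen j y := by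
  have q := I.lt_peak_of_pen_pos h h0
  have a3 := I.peak_anti_left hij h hy
  rw [I.pen_eq_of_lt_peak h q, I.pen_eq_of_lt_peak (hij.trans h) (by linarith), ← mul_sub]
  have := I.net_highest_mono_left hij h
  refine mul_le_mul_of_nonneg_left ?_ I.α_nonneg
  simp only [peak]
  linarith

/-- A highest place for `i` at or behind `j` is available to `j` too, so the peaks differ by at most
`P j - P i` at `x`, and also later by `peak_sub_anti`. Truncating the excess at zero can only shrink
the difference. -/
theorem pen_sub_le_of_le_highest {i j x y : ℕ} (hij : i ≤ j) (h : j ≤ x) (hxy : x ≤ y)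
    (hy : y ≤ n) (hh : j ≤ I.highest i x) :
    I.pen i y - I.pen j y ≤ I.α * (I.tables.P j - I.tables.P i) := by
  have s := I.highest_spec (hij.trans h)
  have := (I.highest_spec h).2.2.1 _ hh s.2.1
  have b1 := I.peak_sub_anti hij h hxy
  have b2 := I.peak_anti_left hij (h.trans hxy) hy
  have b3 : I.peak i x - I.peak j x ≤ I.tables.P j - I.tables.P i := by
    simp only [peak]
    linarith
  rw [I.pen_eq (hij.trans (h.trans hxy)), I.pen_eq (h.trans hxy), ← mul_sub]
  refine mul_le_mul_of_nonneg_left ?_ I.α_nonneg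
  rcases max_cases (I.peak i y - I.Q) 0 with ⟨e1, _⟩ | ⟨e1, _⟩ <;>
    rcases max_cases (I.peak j y - I.Q) 0 with ⟨e2, _⟩ | ⟨e2, _⟩ <;> rw [e1, e2] <;> linarith

/-- Neither place of highest load moves, so both peaks rise by the same delivery quantity. A convex
function has growing increments, and the penalty is convex in the peak. -/
theorem pen_sub_mono_of_net_lt {i j x : ℕ} (hij : i ≤ j) (h : j ≤ x) (hx : x + 1 ≤ n)
    (hlt : I.net (I.highest j x) < I.net (x + 1)) :
    I.pen i x - I.pen j x ≤ I.pen i (x + 1) - I.pen j (x + 1) := by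
  have hlt' := (I.net_highest_mono_left hij h).trans_lt hlt
  have hj := I.highest_succ_of_lt h hlt
  have hi := I.highest_succ_of_lt (hij.trans h) hlt'
  have b2 := I.peak_anti_left hij h (by omega)
  have hD := I.monotone_D (Nat.le_succ x) hx
  have e1 : I.peak j (x + 1) = I.peak j x + (I.tables.D (x + 1) - I.tables.D x) := by
    simp only [peak, hj]
    ring
  have e2 : I.peak i (x + 1) = I.peak i x + (I.tables.D (x + 1) - I.tables.D x) := by
    simp only [peak, hi]
    ring
  rw [I.pen_eq h, I.pen_eq (hij.trans h), I.pen_eq (h.trans (Nat.le_succ x)),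
    I.pen_eq ((hij.trans h).trans (Nat.le_succ x)), ← mul_sub, ← mul_sub, e1, e2]
  refine mul_le_mul_of_nonneg_left ?_ I.α_nonneg
  simp only [Nat.succ_eq_add_one] at hD
  rcases max_cases (I.peak i x - I.Q) 0 with ⟨q1, _⟩ | ⟨q1, _⟩ <;>
    rcases max_cases (I.peak j x - I.Q) 0 with ⟨q2, _⟩ | ⟨q2, _⟩ <;>
    rcases max_cases (I.peak i x + (I.tables.D (x + 1) - I.tables.D x) - I.Q) 0 with
      ⟨q3, _⟩ | ⟨q3, _⟩ <;>
    rcases max_cases (I.peak j x + (I.tables.D (x + 1) - I.tables.D x) - I.Q) 0 with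
      ⟨q4, _⟩ | ⟨q4, _⟩ <;> rw [q1, q2, q3, q4] <;> linarith

end Penalty

/-! ### Shortest paths by recursion on the last arc. -/

section Distance

variable {n : ℕ} (I : Instance ℝ n)

/-- Distance of node `x` from node `0` in the auxiliary graph. -/
noncomputable def minDist (x : ℕ) : ℝ :=
  if h : 0 < x then
    Finset.univ.inf' (⟨⟨0, h⟩, Finset.mem_univ _⟩ : (Finset.univ : Finset (Fin x)).Nonempty)
      fun i => minDist i.1 + I.arcCost i.1 x
  else 0
termination_by x
decreasing_by exact i.2

theorem minDist_zero : I.minDist 0 = 0 := by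
  rw [minDist, dif_neg (lt_irrefl 0)]

theorem minDist_le {i x : ℕ} (h : i < x) : I.minDist x ≤ I.minDist i + I.arcCost i x := by
  rw [minDist, dif_pos (by omega)]
  exact Finset.inf'_le (fun i : Fin x => I.minDist i.1 + I.arcCost i.1 x) (Finset.mem_univ ⟨i, h⟩)

theorem exists_minDist_eq {x : ℕ} (h : 0 < x) : ∃ i < x, I.minDist x = I.minDist i + I.arcCost i x := by
  obtain ⟨i, -, hi⟩ := Finset.exists_mem_eq_inf'
    (⟨⟨0, h⟩, Finset.mem_univ _⟩ : (Finset.univ : Finset (Fin x)).Nonempty)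
    (fun i : Fin x => I.minDist i.1 + I.arcCost i.1 x)
  exact ⟨i, i.2, by rw [minDist, dif_pos h, hi]⟩

/-- Needed because distances peel off the last arc, whereas `pathCost` recurses from the front. -/
theorem pathCost_concat {i x : ℕ} {ℓ : List ℕ} (h : ℓ.getLast? = some i) :
    I.pathCost (ℓ ++ [x]) = I.pathCost ℓ + I.arcCost i x := by
  induction ℓ with
  | nil => simp at h
  | cons a t ih =>
    cases t with
    | nil =>
      simp only [List.getLast?_singleton, Option.some.injEq] at h
      simp [pathCost, h]
    | cons b t =>
      rw [List.getLast?_cons_cons] at h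
      have := ih h
      simp only [List.cons_append, pathCost] at this ⊢
      rw [this, add_assoc]

theorem isPath_concat {i x : ℕ} {ℓ : List ℕ} (h : IsPath i ℓ) (hx : i < x) :
    IsPath x (ℓ ++ [x]) := by
  obtain ⟨h1, h2, h3⟩ := h
  refine ⟨?_, by simp, ?_⟩
  · rw [List.head?_append, h1]
    rfl
  · rw [List.isChain_append]
    refine ⟨h3, by simp, ?_⟩
    simp [h2, hx]

theorem minDist_le_pathCost {x : ℕ} {ℓ : List ℕ} (h : IsPath x ℓ) : I.minDist x ≤ I.pathCost ℓ := by
  induction ℓ using List.reverseRecOn generalizing x with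
  | nil => simp [IsPath] at h
  | append_singleton t y ih =>
    obtain ⟨h1, h2, h3⟩ := h
    obtain rfl : y = x := by simpa using h2
    rcases t.eq_nil_or_concat with rfl | ⟨t', i, rfl⟩
    · obtain rfl : y = 0 := by simpa using h1
      simp [pathCost, minDist_zero]
    · simp only [List.concat_eq_append] at *
      have hlast : (t' ++ [i]).getLast? = some i := by simp
      rw [List.isChain_append] at h3
      have hiy : i < y := h3.2.2 i hlast y (by simp)
      have := ih (x := i) ⟨by
        rw [List.head?_append] at h1
        cases hh : (t' ++ [i]).head? with
        | none => simp at hh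
        | some v => rw [hh] at h1; exact h1, hlast, h3.1⟩
      rw [I.pathCost_concat hlast]
      linarith [I.minDist_le hiy]

theorem isShortestPath_of_pathCost_eq {x : ℕ} {ℓ : List ℕ} (h : IsPath x ℓ)
    (hc : I.pathCost ℓ = I.minDist x) : I.IsShortestPath x ℓ :=
  ⟨h, fun _ h' => hc.trans_le (I.minDist_le_pathCost h')⟩

theorem infix_concat {i y x : ℕ} {ℓ : List ℕ} (h : [i, y] <:+: ℓ ++ [x]) :
    [i, y] <:+: ℓ ∨ (ℓ.getLast? = some i ∧ y = x) := by
  obtain ⟨s, t, h⟩ := h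
  rcases t.eq_nil_or_concat with rfl | ⟨t', z, rfl⟩
  · right
    have : (s ++ [i]) ++ [y] = ℓ ++ [x] := by simpa using h
    obtain ⟨h1, h2⟩ := List.append_inj' this rfl
    exact ⟨by rw [← h1]; simp, by simpa using h2⟩
  · left
    rw [List.concat_eq_append, ← List.append_assoc] at h
    obtain ⟨h1, -⟩ := List.append_inj' h rfl
    exact ⟨s, t', h1⟩

/-- Following optimal predecessors yields a shortest path. -/
theorem exists_path_of_pred {m : ℕ} (pred : ℕ → ℕ) (hlt : ∀ y, 1 ≤ y → y ≤ m → pred y < y)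
    (hpred : ∀ y, 1 ≤ y → y ≤ m → I.minDist (pred y) + I.arcCost (pred y) y = I.minDist y) :
    ∀ x ≤ m, ∃ ℓ, IsPath x ℓ ∧ I.pathCost ℓ = I.minDist x ∧
      ∀ i y, [i, y] <:+: ℓ → pred y = i ∧ 1 ≤ y ∧ y ≤ x := by
  intro x
  induction x using Nat.strong_induction_on with
  | _ x ih =>
    intro hx
    rcases Nat.eq_zero_or_pos x with rfl | h0
    · refine ⟨[0], by simp [IsPath], by simp [pathCost, minDist_zero], fun i y h => ?_⟩
      have := h.length_le
      simp at this
    · obtain ⟨ℓ, p1, p2, p3⟩ := ih (pred x) (hlt x h0 hx) ((hlt x h0 hx).le.trans hx)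
      refine ⟨ℓ ++ [x], isPath_concat p1 (hlt x h0 hx), ?_, fun i y h => ?_⟩
      · rw [I.pathCost_concat p1.2.1, p2, hpred x h0 hx]
      · rcases infix_concat h with h | ⟨h', rfl⟩
        · obtain ⟨q1, q2, q3⟩ := p3 i y h
          exact ⟨q1, q2, q3.trans (hlt x h0 hx).le⟩
        · exact ⟨Option.some.inj (p1.2.1.symm.trans h'), h0, le_rfl⟩

theorem exists_path_of_minDist (x : ℕ) : ∃ ℓ, IsPath x ℓ ∧ I.pathCost ℓ = I.minDist x := by
  have (y : ℕ) : ∃ i, 1 ≤ y → i < y ∧ I.minDist y = I.minDist i + I.arcCost i y := by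
    rcases Nat.eq_zero_or_pos y with rfl | h0
    · exact ⟨0, by simp⟩
    · obtain ⟨i, hi, h⟩ := I.exists_minDist_eq h0
      exact ⟨i, fun _ => ⟨hi, h⟩⟩
  choose pred hp using this
  obtain ⟨ℓ, h1, h2, -⟩ := I.exists_path_of_pred (m := x) pred (fun y h _ => (hp y h).1)
    (fun y h _ => (hp y h).2.symm) x le_rfl
  exact ⟨ℓ, h1, h2⟩

theorem isDist_minDist (x : ℕ) : I.IsDist x (I.minDist x) := by
  obtain ⟨ℓ, h1, h2⟩ := I.exists_path_of_minDist x
  exact ⟨ℓ, I.isShortestPath_of_pathCost_eq h1 h2, h2⟩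

theorem isOptimalPred_of_minDist_eq {i x : ℕ} (h : i < x)
    (he : I.minDist i + I.arcCost i x = I.minDist x) : I.IsOptimalPred i x := by
  obtain ⟨ℓ, h1, h2⟩ := I.exists_path_of_minDist i
  refine ⟨ℓ, h1, I.isShortestPath_of_pathCost_eq (isPath_concat h1 h) ?_⟩
  rw [I.pathCost_concat h1.2.1, h2, he]

end Distance

/-! ### Criteria for discarding a predecessor for good. -/

section Keys

variable {n : ℕ} (I : Instance ℝ n)

/-- Value of `i` as a predecessor as long as there is no penalty, up to a summand that does not
depend on `i`. -/
noncomputable def key (i : ℕ) : ℝ := I.minDist i + I.c 0 (i + 1) - I.tables.C (i + 1)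

/-- Value of `i` as a predecessor under a permanent penalty, up to a summand that does not
depend on `i`. -/
noncomputable def keyP (i : ℕ) : ℝ := I.key i - I.α * I.tables.P i

/-- Value of `i` as a predecessor of `x`, up to a summand that does not depend on `i`. -/
noncomputable def val (i x : ℕ) : ℝ := I.key i + I.pen i x

theorem routeCost_eq {i x : ℕ} (h : i < x) :
    I.routeCost i x = I.c 0 (i + 1) + I.tables.C x - I.tables.C (i + 1) + I.c x 0 := by
  simp only [routeCost, tables]
  rw [Finset.sum_Ico_eq_sub _ (by omega)]
  ring

/-- The bracket is common to all predecessors of `x`, so they are ranked by `val`. -/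
theorem minDist_add_arcCost {i x : ℕ} (h : i < x) :
    I.minDist i + I.arcCost i x = I.val i x + (I.tables.C x + I.c x 0) := by
  rw [arcCost, I.routeCost_eq h, val, key]
  ring

/-- `j` is at least as good a predecessor as `i` for all nodes from `x` on. -/
def Supersedes (x j i : ℕ) : Prop := ∀ y, x ≤ y → y ≤ n → I.val j y ≤ I.val i y

theorem Supersedes.refl (x i : ℕ) : I.Supersedes x i i := fun _ _ _ => le_rfl

variable {I} in
theorem Supersedes.trans {x i j k : ℕ} (h : I.Supersedes x i j) (h' : I.Supersedes x j k) :
    I.Supersedes x i k := fun y h1 h2 => (h y h1 h2).trans (h' y h1 h2)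

/-- The later start never pays more than the earlier one. -/
theorem supersedes_of_key_le {i j x : ℕ} (hij : i ≤ j) (hj : j ≤ x) (h : I.key j ≤ I.key i) :
    I.Supersedes x j i := fun y h1 h2 => by
  have := I.pen_anti_left hij (hj.trans h1) h2
  simp only [val]
  linarith

/-- At a node where `j` is free, its present advantage has been preserved. At a node where `j` pays,
the gap is at least that of a permanent penalty, for which `keyP` decides. -/
theorem supersedes_of_keyP_le {i j x : ℕ} (hij : i ≤ j) (hj : j ≤ x) (h : I.keyP j ≤ I.keyP i)
    (hx : I.val j x ≤ I.val i x) : I.Supersedes x j i := fun y h1 h2 => by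
  simp only [val, keyP] at *
  rcases (I.pen_nonneg j y).eq_or_lt with h0 | h0
  · linarith [I.pen_sub_mono_of_pen_eq_zero hij hj h1 h2 h0.symm]
  · linarith [I.le_pen_sub_of_pen_pos hij (hj.trans h1) h2 h0]

/-- Once the later start pays, the gap moves only in favour of the earlier one, so a present tie or
disadvantage is final. -/
theorem supersedes_of_pen_pos {i j x : ℕ} (hij : i ≤ j) (hj : j ≤ x) (h : 0 < I.pen j x)
    (hx : I.val i x ≤ I.val j x) : I.Supersedes x i j := fun y h1 h2 => by
  simp only [val] at *
  linarith [I.pen_sub_anti_of_pen_pos hij hj h1 h2 h]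

/-- With the highest place of `i` at or behind `j`, the gap never exceeds that of a permanent
penalty again. -/
theorem supersedes_of_le_highest {i j x : ℕ} (hij : i ≤ j) (hj : j ≤ x)
    (hh : j ≤ I.highest i x) (h : I.keyP i ≤ I.keyP j) : I.Supersedes x i j := fun y h1 h2 => by
  simp only [val, keyP] at *
  linarith [I.pen_sub_le_of_le_highest hij hj h1 h2 hh]

end Keys

end Instance

end SoftVRPSPD

namespace SoftVRPSPD

/-! ### The queue as a zipper, on which its operations are list patterns. -/

namespace CursorDeque

/-- The queue with the cursor at `b`, the elements in front of it being those of `L` from back to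
front, and the elements behind it those of `R` from front to back. -/
def zip (L : List ℕ) (b : ℕ) (R : List ℕ) : CursorDeque := ⟨L.reverse ++ b :: R, some L.length⟩

/-- The queue without a cursor that has the elements of `L` from back to front. -/
def off (L : List ℕ) : CursorDeque := ⟨L.reverse, none⟩

variable (L : List ℕ) (a b : ℕ) (R : List ℕ)

@[simp] theorem zip_items : (zip L b R).items = L.reverse ++ b :: R := rfl

@[simp] theorem zip_cur : (zip L b R).cur = some L.length := rfl

@[simp] theorem off_items : (off L).items = L.reverse := rfl

@[simp] theorem off_cur : (off L).cur = none := rfl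

@[simp] theorem zip_best? : (zip L b R).best? = some b := by
  simp [best?]

@[simp] theorem off_best? : (off L).best? = none := rfl

@[simp] theorem zip_nil_prev? : (zip [] b R).prev? = none := rfl

@[simp] theorem zip_cons_prev? : (zip (a :: L) b R).prev? = some a := by
  simp [prev?]

@[simp] theorem zip_nil_next? : (zip L b []).next? = none := by
  simp [next?]

@[simp] theorem zip_cons_next? : (zip L b (a :: R)).next? = some a := by
  simp [next?, List.getElem?_append]

@[simp] theorem zip_removePrev : (zip (a :: L) b R).removePrev = zip L b R := by
  simp [removePrev, zip, List.eraseIdx_append]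

@[simp] theorem zip_removeNext : (zip L b (a :: R)).removeNext = zip L b R := by
  simp [removeNext, zip, List.eraseIdx_append]

@[simp] theorem zip_moveNext : (zip L b (a :: R)).moveNext = zip (b :: L) a R := by
  simp [moveNext, zip]

@[simp] theorem zip_movePrev_removeNext :
    (zip (a :: L) b R).movePrev.removeNext = zip L a R := by
  simp [movePrev, removeNext, zip, List.eraseIdx_append]

@[simp] theorem zip_nil_back? : (zip L b []).back? = some b := by
  simp [back?]

@[simp] theorem zip_append_back? : (zip L b (R ++ [a])).back? = some a := by
  rw [back?, zip_items, ← List.cons_append, ← List.append_assoc, List.getLast?_concat]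

@[simp] theorem zip_append_removeBack : (zip L b (R ++ [a])).removeBack = zip L b R := by
  simp only [removeBack, zip, CursorDeque.mk.injEq, and_true]
  rw [← List.cons_append, ← List.append_assoc, List.dropLast_concat]

@[simp] theorem zip_nullBest_removeBack : (zip L b []).nullBest.removeBack = off L := by
  simp [removeBack, nullBest, zip, off]

@[simp] theorem zip_insertBack : (zip L b R).insertBack a = zip L b (R ++ [a]) := by
  simp [insertBack, zip]

@[simp] theorem off_nil_back? : (off []).back? = none := rfl

@[simp] theorem off_cons_back? : (off (a :: L)).back? = some a := by
  simp [back?]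

@[simp] theorem off_cons_removeBack : (off (a :: L)).removeBack = off L := by
  simp [removeBack, off]

@[simp] theorem off_insertBack : (off L).insertBack a = off (a :: L) := by
  simp [insertBack, off]

@[simp] theorem off_bestToBack : (off (a :: L)).bestToBack = zip L a [] := by
  simp [bestToBack, zip, off]

end CursorDeque

/-! ### Runs of the machine with amortized step counts. -/

/-- Credit for the amortized analysis. -/
def State.credit {K : Type} (s : State K) : ℤ :=
  -- An element of the queue is worth 20 at the cursor or behind it and 10 in front of it, so moving
  -- the cursor forward, deleting an element, and moving back with deletion of the old cursor
  -- element all release at least 10.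
  5 * s.queueH.length + match s.queue.cur with
    | some k => 20 * s.queue.items.length - 10 * k
    | none => 10 * s.queue.items.length

namespace Instance

variable {n : ℕ} (I : Instance ℝ n)

/-- `k` steps lead from `s` to `s'`. -/
inductive Steps : ℕ → State ℝ → State ℝ → Prop
  | refl (s) : Steps 0 s s
  | cons {k s s' s''} : I.step s = some s' → Steps k s' s'' → Steps (k + 1) s s''

variable {I}

theorem Steps.trans {k l : ℕ} {s s' s'' : State ℝ} (h : I.Steps k s s') (h' : I.Steps l s' s'') :
    I.Steps (k + l) s s'' := by
  induction h with
  | refl => simpa using h'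
  | cons h _ ih =>
    rw [Nat.add_right_comm]
    exact .cons h (ih h')

theorem Steps.run_eq {k t : ℕ} {s s' : State ℝ} (h : I.Steps k s s') (hs : I.run t = some s) :
    I.run (t + k) = some s' := by
  induction h generalizing t with
  | refl => exact hs
  | cons h _ ih =>
    have := @ih (t + 1) (by rw [run, hs]; exact h)
    rwa [Nat.add_assoc, Nat.add_comm 1] at this

variable (I) in
/-- `s'` can be reached from `s` in at most `m` steps, apart from those that are paid by credit. -/
def Reach (m : ℤ) (s s' : State ℝ) : Prop :=
  ∃ k : ℕ, I.Steps k s s' ∧ k + s'.credit ≤ s.credit + m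

theorem Reach.refl {m : ℤ} (hm : 0 ≤ m) (s : State ℝ) : I.Reach m s s :=
  ⟨0, .refl s, by simpa using hm⟩

theorem Reach.trans {m m' : ℤ} {s s' s'' : State ℝ} (h : I.Reach m s s') (h' : I.Reach m' s' s'') :
    I.Reach (m + m') s s'' := by
  obtain ⟨k, h1, h2⟩ := h
  obtain ⟨k', h1', h2'⟩ := h'
  exact ⟨k + k', h1.trans h1', by push_cast; linarith⟩

theorem Reach.mono {m m' : ℤ} {s s' : State ℝ} (h : I.Reach m s s') (hm : m ≤ m') :
    I.Reach m' s s' := by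
  obtain ⟨k, h1, h2⟩ := h
  exact ⟨k, h1, by linarith⟩

theorem Reach.cons {m m' : ℤ} {s s' s'' : State ℝ} (h : I.step s = some s')
    (h' : I.Reach m s' s'') (hm : 1 + m + s'.credit ≤ m' + s.credit) : I.Reach m' s s'' := by
  obtain ⟨k, h1, h2⟩ := h'
  exact ⟨k + 1, .cons h h1, by push_cast; linarith⟩

theorem Reach.single {m : ℤ} {s s' : State ℝ} (h : I.step s = some s')
    (hm : 1 + s'.credit ≤ m + s.credit) : I.Reach m s s' :=
  .cons h (.refl le_rfl s') (by linarith)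

variable (I) in
/-- The tables and the array `pot` have the right entries in iteration `x`. -/
structure Valid (tb : Tables ℝ) (pot : ℕ → ℝ) (x : ℕ) : Prop where
  le : x ≤ n
  C_eq : ∀ i ≤ n, tb.C i = I.tables.C i
  D_eq : ∀ i ≤ n, tb.D i = I.tables.D i
  P_eq : ∀ i ≤ n, tb.P i = I.tables.P i
  pot_eq : ∀ i < x, pot i = I.minDist i

/-! ### The tests of the machine as comparisons of `key`, `keyP`, `net` and `val`. -/

section Comparisons

variable {tb : Tables ℝ} {pot : ℕ → ℝ} {x : ℕ}

theorem Valid.dominates_iff (v : I.Valid tb pot x) {i j : ℕ} (hi : i < x) (hj : j < x) :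
    I.dominates tb pot i j ↔ I.key i < I.key j := by
  have := v.le
  rw [dominates, v.C_eq _ (by omega), v.C_eq _ (by omega), v.pot_eq i hi, v.pot_eq j hj, key, key]
  constructor <;> intro h <;> linarith

theorem Valid.dominatesP_iff (v : I.Valid tb pot x) {i j : ℕ} (hi : i < x) (hj : j < x) :
    I.dominatesP tb pot i j ↔ I.keyP i < I.keyP j := by
  have := v.le
  rw [dominatesP, v.C_eq _ (by omega), v.C_eq _ (by omega), v.P_eq _ (by omega),
    v.P_eq _ (by omega), v.pot_eq i hi, v.pot_eq j hj, keyP, keyP, key, key]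
  constructor <;> intro h <;> linarith

theorem Valid.dominatesH_iff (v : I.Valid tb pot x) {i j : ℕ} (hi : i ≤ x) (hj : j ≤ x) :
    dominatesH tb i j ↔ I.net i < I.net j := by
  have := v.le
  rw [dominatesH, v.D_eq _ (by omega), v.D_eq _ (by omega), v.P_eq _ (by omega),
    v.P_eq _ (by omega), net, net]
  constructor <;> intro h <;> linarith

theorem Valid.penAt_eq (v : I.Valid tb pot x) {i j : ℕ} (hi : i ≤ x) (hj : j = I.highest i x) :
    I.penAt tb i j x = I.pen i x := by
  have := v.le
  obtain ⟨h1, h2, -⟩ := I.highest_spec hi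
  rw [I.pen_eq hi, penAt, hj, v.D_eq _ this, v.D_eq _ (by omega), v.P_eq _ (by omega),
    v.P_eq _ (by omega), peak, net]
  congr 2
  ring

theorem Valid.dominatesA_iff (v : I.Valid tb pot x) {i j k l : ℕ} (hi : i < x) (hk : k < x)
    (hj : j = I.highest i x) (hl : l = I.highest k x) :
    I.dominatesA tb pot i j k l x ↔ I.val i x < I.val k x := by
  have := v.le
  rw [dominatesA, v.penAt_eq hi.le hj, v.penAt_eq hk.le hl, v.C_eq _ (by omega),
    v.C_eq _ (by omega), v.pot_eq i hi, v.pot_eq k hk, val, val, key, key]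
  constructor <;> intro h <;> linarith

theorem Valid.costAt_eq (v : I.Valid tb pot x) {i j : ℕ} (hi : i < x) (hj : j = I.highest i x) :
    I.costAt tb i j x = I.arcCost i x := by
  have := v.le
  rw [costAt, v.penAt_eq hi.le hj, v.C_eq _ (by omega), v.C_eq _ (by omega), arcCost,
    I.routeCost_eq hi]

end Comparisons

/-! ### The inner removal loops. -/

section Loops

open CursorDeque

variable {x : ℕ} {q : CursorDeque} {H : List ℕ} {h : ℕ → ℕ} {pot : ℕ → ℝ} {pred : ℕ → ℕ}
  {tb : Tables ℝ}

@[simp] theorem credit_zip {line : Line} (L b R) :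
    (⟨line, x, zip L b R, H, h, pot, pred, tb⟩ : State ℝ).credit
      = 5 * H.length + (10 * L.length + 20 * R.length + 20) := by
  simp [State.credit]
  ring

@[simp] theorem credit_off {line : Line} (L) :
    (⟨line, x, off L, H, h, pot, pred, tb⟩ : State ℝ).credit = 5 * H.length + 10 * L.length := by
  simp [State.credit]

/-- Removal of elements in front of the cursor that are never again better than the cursor. -/
theorem reach_prune (v : I.Valid tb pot x) {check body exit : Line}
    -- The same loop occurs at three places of the program; describing it by its two steps serves
    -- all of them, and the hypotheses hold by `rfl`.
    (hcheck : ∀ q : CursorDeque, I.step ⟨check, x, q, H, h, pot, pred, tb⟩ = match q.prev? with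
      | some a => q.best?.bind fun b =>
        if I.dominatesP tb pot a b then some ⟨exit, x, q, H, h, pot, pred, tb⟩
        else some ⟨body, x, q, H, h, pot, pred, tb⟩
      | none => some ⟨exit, x, q, H, h, pot, pred, tb⟩)
    (hbody : ∀ q : CursorDeque, I.step ⟨body, x, q, H, h, pot, pred, tb⟩
      = some ⟨check, x, q.removePrev, H, h, pot, pred, tb⟩)
    {b : ℕ} (hb : b < x) (R : List ℕ) (L : List ℕ) (hL : ∀ i ∈ L, i < x)
    (hP : L.Pairwise fun j i => I.keyP i < I.keyP j) :
    ∃ L', L' <:+ L ∧ (∀ i ∈ L', I.keyP i < I.keyP b) ∧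
      (∀ i ∈ L, i ∈ L' ∨ I.keyP b ≤ I.keyP i) ∧
      I.Reach 1 ⟨check, x, zip L b R, H, h, pot, pred, tb⟩
        ⟨exit, x, zip L' b R, H, h, pot, pred, tb⟩ := by
  induction L with
  | nil =>
    refine ⟨[], List.suffix_rfl, by simp, by simp,
      .single (s' := ⟨exit, x, zip [] b R, H, h, pot, pred, tb⟩) ?_ (by simp)⟩
    rw [hcheck]
    simp
  | cons a L ih =>
    rw [List.forall_mem_cons] at hL
    rw [List.pairwise_cons] at hP
    by_cases hd : I.keyP a < I.keyP b
    · refine ⟨a :: L, List.suffix_rfl, ?_, fun i hi => .inl hi, .single ?_ (by simp)⟩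
      · rw [List.forall_mem_cons]
        -- `keyP` increases towards the cursor, so if the nearest element passes the test, all those
        -- in front of it do.
        exact ⟨hd, fun i hi => (hP.1 i hi).trans hd⟩
      · rw [hcheck]
        simp [v.dominatesP_iff hL.1 hb, hd]
    · obtain ⟨L', h1, h2, h3, h4⟩ := ih hL.2 hP.2
      refine ⟨L', h1.trans (List.suffix_cons _ _), h2, ?_, ?_⟩
      · rw [List.forall_mem_cons]
        exact ⟨.inr (not_lt.1 hd), h3⟩
      -- Each `m` is the budget left over. The deletion releases 10 credits, enough for the two
      -- steps of one pass.
      · refine .cons (s' := ⟨body, x, zip (a :: L) b R, H, h, pot, pred, tb⟩) (m := 0) ?_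
          (.cons ((hbody _).trans (by rw [zip_removePrev])) h4 ?_) ?_
        · rw [hcheck]
          simp [v.dominatesP_iff hL.1 hb, hd]
        · simp only [credit_zip, List.length_cons]
          push_cast
          linarith
        · simp

/-- Removal from the back of `queueH`. -/
theorem reach_popH (v : I.Valid tb pot x) (H : List ℕ) (hH : ∀ z ∈ H, z ≤ x)
    (hE : H.Pairwise fun i j => I.net i < I.net j) :
    I.Reach 1 ⟨.l12, x, q, H, h, pot, pred, tb⟩
      ⟨.l14, x, q, H.filter (fun z => I.net z < I.net x), h, pot, pred, tb⟩ := by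
  induction H using List.reverseRecOn with
  | nil => exact .single (by simp [step]) (by simp [State.credit])
  | append_singleton H a ih =>
    have ha : a ≤ x := hH a (by simp)
    rw [List.pairwise_append] at hE
    by_cases hd : I.net a < I.net x
    -- `net` increases along the list, so once the back passes the test all entries do; hence
    -- stopping there amounts to filtering.
    · have : (H ++ [a]).filter (fun z => I.net z < I.net x) = H ++ [a] := by
        rw [List.filter_eq_self]
        intro z hz
        rw [List.mem_append, List.mem_singleton] at hz
        rcases hz with hz | rfl
        · simpa using (hE.2.2 z hz a (by simp)).trans hd
        · simpa using hd
      rw [this]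
      exact .single (by simp [step, v.dominatesH_iff ha le_rfl, hd])
        (by simp [State.credit])
    · have e : (H ++ [a]).filter (fun z => I.net z < I.net x)
          = H.filter (fun z => I.net z < I.net x) := by
        simp [hd]
      rw [e]
      refine .cons (s' := ⟨.l13, x, q, H ++ [a], h, pot, pred, tb⟩) (m := 0) ?_
        (.cons (s' := ⟨.l12, x, q, H, h, pot, pred, tb⟩) ?_
          (ih (fun z hz => hH z (by simp [hz])) hE.1) ?_) ?_
      · simp [step, v.dominatesH_iff ha le_rfl, hd]
      · simp [step]
      · simp [State.credit]
        linarith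
      · simp [State.credit]

/-- Removal from the front of `queueH`. -/
theorem reach_dropH {check body exit : Line}
    (hcheck : ∀ H : List ℕ, I.step ⟨check, x, q, H, h, pot, pred, tb⟩ =
      H.head?.bind fun f => q.next?.bind fun a =>
        if f < a then some ⟨body, x, q, H, h, pot, pred, tb⟩
        else some ⟨exit, x, q, H, h, pot, pred, tb⟩)
    (hbody : ∀ H : List ℕ, I.step ⟨body, x, q, H, h, pot, pred, tb⟩
      = some ⟨check, x, q, H.tail, h, pot, pred, tb⟩)
    {a : ℕ} (ha : q.next? = some a) (H : List ℕ) (hH : ∃ z ∈ H, a ≤ z)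
    (hE : H.Pairwise (· < ·)) :
    I.Reach 1 ⟨check, x, q, H, h, pot, pred, tb⟩
      ⟨exit, x, q, H.filter (fun z => a ≤ z), h, pot, pred, tb⟩ := by
  induction H with
  | nil => simp at hH
  | cons z H ih =>
    rw [List.pairwise_cons] at hE
    by_cases hd : z < a
    · have e : (z :: H).filter (fun z => a ≤ z) = H.filter (fun z => a ≤ z) := by
        simp [hd]
      rw [e]
      refine .cons (s' := ⟨body, x, q, z :: H, h, pot, pred, tb⟩) (m := 0) ?_
        (.cons (s' := ⟨check, x, q, H, h, pot, pred, tb⟩) ?_ (ih ?_ hE.2) ?_) ?_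
      · rw [hcheck]
        simp [ha, hd]
      · rw [hbody]
        simp
      · obtain ⟨w, hw, haw⟩ := hH
        rcases List.mem_cons.1 hw with rfl | hw
        · omega
        · exact ⟨w, hw, haw⟩
      · simp [State.credit]
        linarith
      · simp [State.credit]
    · have e : (z :: H).filter (fun z => a ≤ z) = z :: H := by
        rw [List.filter_eq_self, List.forall_mem_cons]
        refine ⟨by simpa using hd, fun w hw => ?_⟩
        have := hE.1 w hw
        simp
        omega
      rw [e]
      refine .single ?_ (by simp [State.credit])
      rw [hcheck]
      simp [ha, hd]

/-- Removal from the back of the queue when there is no cursor. -/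
theorem reach_popOff (v : I.Valid tb pot x) (hx : 1 ≤ x) (L : List ℕ) (hL : ∀ i ∈ L, i < x)
    (hA : L.Pairwise fun j i => I.key i < I.key j) :
    ∃ L', L' <:+ L ∧ (∀ i ∈ L', I.key i < I.key (x - 1)) ∧
      (∀ i ∈ L, i ∈ L' ∨ I.key (x - 1) ≤ I.key i) ∧
      I.Reach 1 ⟨.l3, x, off L, H, h, pot, pred, tb⟩ ⟨.l7, x, off L', H, h, pot, pred, tb⟩ := by
  induction L with
  | nil =>
    exact ⟨[], List.suffix_rfl, by simp, by simp,
      .single (s' := ⟨.l7, x, off [], H, h, pot, pred, tb⟩) (by simp [step]) (by simp)⟩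
  | cons a L ih =>
    rw [List.forall_mem_cons] at hL
    rw [List.pairwise_cons] at hA
    by_cases hd : I.key a < I.key (x - 1)
    · refine ⟨a :: L, List.suffix_rfl, ?_, fun i hi => .inl hi, .single ?_ (by simp)⟩
      · rw [List.forall_mem_cons]
        exact ⟨hd, fun i hi => (hA.1 i hi).trans hd⟩
      · simp [step, v.dominates_iff hL.1 (show x - 1 < x by omega), hd]
    · obtain ⟨L', h1, h2, h3, h4⟩ := ih hL.2 hA.2
      refine ⟨L', h1.trans (List.suffix_cons _ _), h2, ?_, ?_⟩
      · rw [List.forall_mem_cons]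
        exact ⟨.inr (not_lt.1 hd), h3⟩
      · refine .cons (s' := ⟨.l4, x, off (a :: L), H, h, pot, pred, tb⟩) (m := 0) ?_
          -- The negative budget is a debt, repaid by the credit that the deletion releases.
          (.cons (s' := ⟨.l6, x, off (a :: L), H, h, pot, pred, tb⟩) (m := -1) ?_
          (.cons (s' := ⟨.l3, x, off L, H, h, pot, pred, tb⟩) ?_ h4 ?_) ?_) ?_
        · simp [step, v.dominates_iff hL.1 (show x - 1 < x by omega), hd]
        · simp [step]
        · simp [step]
        · simp
          linarith
        · simp
        · simp

/-- Removal from the back of the queue. -/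
theorem reach_popBack (v : I.Valid tb pot x) (hx : 1 ≤ x) (L : List ℕ) (b : ℕ) (R : List ℕ)
    (hlt : ∀ i ∈ L.reverse ++ b :: R, i < x)
    (hA : (L.reverse ++ b :: R).Pairwise fun i j => i < j ∧ I.key i < I.key j) :
    (∃ R', R' <+: R ∧ (∀ i ∈ L.reverse ++ b :: R', I.key i < I.key (x - 1)) ∧
      (∀ i ∈ R, i ∈ R' ∨ I.key (x - 1) ≤ I.key i) ∧
      I.Reach 5 ⟨.l3, x, zip L b R, H, h, pot, pred, tb⟩
        ⟨.l7, x, zip L b R', H, h, pot, pred, tb⟩) ∨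
    ∃ L', L' <:+ L ∧ (∀ i ∈ L', I.key i < I.key (x - 1)) ∧
      (∀ i ∈ L.reverse ++ b :: R, i ∈ L' ∨ I.key (x - 1) ≤ I.key i) ∧
      I.key (x - 1) ≤ I.key b ∧
      I.Reach 5 ⟨.l3, x, zip L b R, H, h, pot, pred, tb⟩
        ⟨.l7, x, off L', H, h, pot, pred, tb⟩ := by
  induction R using List.reverseRecOn with
  | nil =>
    have hb : b < x := hlt b (by simp)
    have hA' := List.pairwise_append.1 hA
    by_cases hd : I.key b < I.key (x - 1)
    · left
      refine ⟨[], List.prefix_rfl, fun i hi => ?_, by simp, .single ?_ (by simp)⟩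
      · simp only [List.mem_append, List.mem_singleton] at hi
        rcases hi with hi | rfl
        · exact (hA'.2.2 i hi b (by simp)).2.trans hd
        · exact hd
      · simp [step, v.dominates_iff hb (show x - 1 < x by omega), hd]
    · right
      obtain ⟨L', h1, h2, h3, h4⟩ := reach_popOff (H := H) (h := h) (pred := pred) v hx L
        (fun i hi => hlt i (by simp [hi]))
        (by simpa [List.pairwise_reverse] using hA'.1.imp And.right)
      refine ⟨L', h1, h2, fun i hi => ?_, not_lt.1 hd, ?_⟩
      · simp only [List.mem_append, List.mem_reverse, List.mem_singleton] at hi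
        rcases hi with hi | rfl
        · exact h3 i hi
        · exact .inr (not_lt.1 hd)
      · refine .cons (s' := ⟨.l4, x, zip L b [], H, h, pot, pred, tb⟩) (m := 4) ?_
          (.cons (s' := ⟨.l5, x, zip L b [], H, h, pot, pred, tb⟩) (m := 3) ?_
          (.cons (s' := ⟨.l6, x, (zip L b []).nullBest, H, h, pot, pred, tb⟩)
            -- Nulling the cursor at the last element lowers its worth from 20 to 10; the difference
            -- is added to the 2 units still left.
            (m := 2 + 10 * L.length + 20 - 10 * (L.length + 1)) ?_
          (.cons (s' := ⟨.l3, x, off L, H, h, pot, pred, tb⟩) ?_ h4 ?_) ?_) ?_) ?_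
        · simp [step, v.dominates_iff hb (show x - 1 < x by omega), hd]
        · simp [step]
        · simp [step]
        · simp [step]
        · simp [State.credit, nullBest]
          linarith
        · simp [State.credit, nullBest]
          linarith
        · simp
        · simp
  | append_singleton R a ih =>
    have ha : a < x := hlt a (by simp)
    have e : L.reverse ++ b :: (R ++ [a]) = (L.reverse ++ b :: R) ++ [a] := by simp
    rw [e] at hlt hA
    have hA' := List.pairwise_append.1 hA
    -- The machine compares `best?` and `back?` by value; the strict order of the queue makes this a
    -- comparison of positions.
    have hab : ¬ b = a := fun hab => by
      have := (hA'.2.2 b (by simp) a (by simp)).1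
      omega
    by_cases hd : I.key a < I.key (x - 1)
    · left
      refine ⟨R ++ [a], List.prefix_rfl, fun i hi => ?_, fun i hi => .inl hi, .single ?_ (by simp)⟩
      · rw [e, List.mem_append, List.mem_singleton] at hi
        rcases hi with hi | rfl
        · exact (hA'.2.2 i hi a (by simp)).2.trans hd
        · exact hd
      · simp [step, v.dominates_iff ha (show x - 1 < x by omega), hd]
    · have hr : ∀ {s' : State ℝ}, I.Reach 5 ⟨.l3, x, zip L b R, H, h, pot, pred, tb⟩ s' →
          I.Reach 5 ⟨.l3, x, zip L b (R ++ [a]), H, h, pot, pred, tb⟩ s' := fun h4 => by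
        refine .cons (s' := ⟨.l4, x, zip L b (R ++ [a]), H, h, pot, pred, tb⟩) (m := 4) ?_
          (.cons (s' := ⟨.l6, x, zip L b (R ++ [a]), H, h, pot, pred, tb⟩) (m := 3) ?_
          (.cons (s' := ⟨.l3, x, zip L b R, H, h, pot, pred, tb⟩) ?_ h4 ?_) ?_) ?_
        · simp [step, v.dominates_iff ha (show x - 1 < x by omega), hd]
        · simp [step, hab]
        · simp [step]
        · simp
          linarith
        · simp
        · simp
      rcases ih (fun i hi => hlt i (List.mem_append_left _ hi)) hA'.1 with
        ⟨R', h1, h2, h3, h4⟩ | ⟨L', h1, h2, h3, h5, h4⟩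
      · refine .inl ⟨R', h1.trans (List.prefix_append _ _), h2, fun i hi => ?_, hr h4⟩
        rw [List.mem_append, List.mem_singleton] at hi
        rcases hi with hi | rfl
        · exact h3 i hi
        · exact .inr (not_lt.1 hd)
      · refine .inr ⟨L', h1, h2, fun i hi => ?_, h5, hr h4⟩
        rw [e, List.mem_append, List.mem_singleton] at hi
        rcases hi with hi | rfl
        · exact h3 i hi
        · exact .inr (not_lt.1 hd)

end Loops

end Instance

end SoftVRPSPD

namespace SoftVRPSPD

/-! ### Invariants of the two queues. -/

namespace Instance

variable {n : ℕ} (I : Instance ℝ n)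

/-- Every `i < N` is superseded from node `N` on by an element of `S`. -/
def Covers (N : ℕ) (S : List ℕ) : Prop := ∀ i < N, ∃ j ∈ S, I.Supersedes N j i

variable {I} in
theorem Covers.imp {N : ℕ} {S S' : List ℕ} (h : I.Covers N S)
    (h' : ∀ i ∈ S, ∃ j ∈ S', I.Supersedes N j i) : I.Covers N S' := fun i hi => by
  obtain ⟨j, hj, hs⟩ := h i hi
  obtain ⟨k, hk, hs'⟩ := h' j hj
  exact ⟨k, hk, hs'.trans hs⟩

/-- The cursor element `b` and the elements `L` in front of it (from back to front): each one is
at present no better than the elements behind it, but would be better under a permanent penalty. -/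
structure Front (t : ℕ) (h : ℕ → ℕ) (b : ℕ) (L : List ℕ) : Prop where
  chain : (b :: L).Pairwise fun j i => i < j ∧ I.val j t ≤ I.val i t ∧ I.keyP i < I.keyP j
  pen_pos : ∀ i ∈ L, 0 < I.pen i t
  h_eq : ∀ i ∈ b :: L, h i = I.highest i t

/-- The queue after node `t`, being about to contain only elements smaller than `N`. -/
structure Queue (t N : ℕ) (h : ℕ → ℕ) (b : ℕ) (L R : List ℕ) : Prop where
  inc : ((b :: L).reverse ++ R).Pairwise fun i j => i < j ∧ I.key i < I.key j
  lt : ∀ i ∈ (b :: L).reverse ++ R, i < N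
  front : I.Front t h b L
  covers : I.Covers N ((b :: L).reverse ++ R)

/-- `H` consists of the nodes from `lo` to `t` with a smaller net delivery than all later nodes
up to `t`. -/
structure Records (t lo : ℕ) (H : List ℕ) : Prop where
  sorted : H.Pairwise (· < ·)
  mem_iff : ∀ z, z ∈ H ↔ lo ≤ z ∧ z ≤ t ∧ ∀ w, z < w → w ≤ t → I.net z < I.net w

variable {I}

theorem Records.pairwise_net {t lo : ℕ} {H : List ℕ} (r : I.Records t lo H) :
    H.Pairwise fun i j => I.net i < I.net j :=
  r.sorted.imp_of_mem fun hi hj hij =>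
    ((r.mem_iff _).1 hi).2.2 _ hij ((r.mem_iff _).1 hj).2.1

/-- The new node eliminates exactly the records whose `net` is not smaller, and is itself a record
for lack of later nodes. -/
theorem Records.succ {t lo : ℕ} {H : List ℕ} (r : I.Records t lo H) (hlo : lo ≤ t) :
    I.Records (t + 1) lo (H.filter (fun z => I.net z < I.net (t + 1)) ++ [t + 1]) := by
  refine ⟨?_, fun z => ?_⟩
  · rw [List.pairwise_append]
    refine ⟨r.sorted.filter _, by simp, fun z hz w hw => ?_⟩
    have := ((r.mem_iff z).1 (List.mem_filter.1 hz).1).2.1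
    rw [List.mem_singleton] at hw
    omega
  · rw [List.mem_append, List.mem_filter, List.mem_singleton, r.mem_iff]
    simp only [decide_eq_true_eq]
    constructor
    · rintro (⟨⟨h1, h2, h3⟩, h4⟩ | rfl)
      · refine ⟨h1, by omega, fun w hw hw' => ?_⟩
        rcases Nat.lt_or_ge t w with hk | hk
        · obtain rfl : w = t + 1 := by omega
          exact h4
        · exact h3 w hw hk
      · exact ⟨by omega, le_rfl, fun w hw hw' => by omega⟩
    · rintro ⟨h1, h2, h3⟩
      rcases Nat.lt_or_ge t z with hk | hk
      · right
        omega
      · exact .inl ⟨⟨h1, hk, fun w hw hw' => h3 w hw (by omega)⟩, h3 _ (by omega) le_rfl⟩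

theorem Records.filter {t lo a : ℕ} {H : List ℕ} (r : I.Records t lo H) (ha : lo ≤ a) :
    I.Records t a (H.filter fun z => a ≤ z) := by
  refine ⟨r.sorted.filter _, fun z => ?_⟩
  rw [List.mem_filter, r.mem_iff]
  simp only [decide_eq_true_eq]
  constructor
  · rintro ⟨⟨_, h2⟩, h3⟩
    exact ⟨h3, h2⟩
  · rintro ⟨h1, h2⟩
    exact ⟨⟨ha.trans h1, h2⟩, h1⟩

theorem Records.highest_mem {t lo : ℕ} {H : List ℕ} (r : I.Records t lo H) {a : ℕ} (ha : lo ≤ a)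
    (hat : a ≤ t) : I.highest a t ∈ H := by
  obtain ⟨h1, h2, -, h4⟩ := I.highest_spec hat
  exact (r.mem_iff _).2 ⟨ha.trans h1, h2, h4⟩

/-- The last minimizer on the window is a record. A record in front of it would have a strictly
smaller `net`, against minimality. -/
theorem Records.head?_eq {t lo : ℕ} {H : List ℕ} (r : I.Records t lo H) (h : lo ≤ t) :
    H.head? = some (I.highest lo t) := by
  have hm := r.highest_mem le_rfl h
  obtain ⟨-, h2, h3, -⟩ := I.highest_spec h
  cases H with
  | nil => simp at hm
  | cons z H =>
    obtain ⟨z1, z2, z3⟩ := (r.mem_iff z).1 (by simp)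
    have hs := r.sorted
    rw [List.pairwise_cons] at hs
    rcases List.mem_cons.1 hm with e | hm
    · rw [e]
      rfl
    · exact absurd (z3 _ (hs.1 _ hm) h2) (not_lt.2 (h3 z z1 z2))

theorem Front.sublist {t : ℕ} {h : ℕ → ℕ} {b b' : ℕ} {L L' : List ℕ} (f : I.Front t h b L)
    (hs : b' :: L' <:+ b :: L) : I.Front t h b' L' := by
  refine ⟨f.chain.sublist hs.sublist, fun i hi => f.pen_pos i ?_, fun i hi => f.h_eq i (hs.subset hi)⟩
  rcases List.suffix_cons_iff.1 hs with e | hs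
  · rw [List.cons.injEq] at e
    rwa [← e.2]
  · exact hs.subset (List.mem_cons_of_mem _ hi)

/-- Elements in front of the cursor have minima of `net` no larger than that of the cursor. So if
the new node does not displace the cursor's highest place it displaces none, and all gaps move in
favour of the later element. -/
theorem Front.succ {t : ℕ} {h : ℕ → ℕ} {b : ℕ} {L : List ℕ} (f : I.Front t h b L) (hb : b ≤ t)
    (ht : t + 1 ≤ n) (hlt : I.net (I.highest b t) < I.net (t + 1)) : I.Front (t + 1) h b L := by
  have hle : ∀ i ∈ b :: L, i ≤ b := by
    rw [List.forall_mem_cons]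
    exact ⟨le_rfl, fun i hi => ((List.pairwise_cons.1 f.chain).1 i hi).1.le⟩
  have hnet : ∀ i ∈ b :: L, I.net (I.highest i t) < I.net (t + 1) := fun i hi =>
    (I.net_highest_mono_left (hle i hi) hb).trans_lt hlt
  refine ⟨f.chain.imp_of_mem ?_, fun i hi => ?_, fun i hi => ?_⟩
  · rintro j i hj hi ⟨h1, h2, h3⟩
    refine ⟨h1, ?_, h3⟩
    have := I.pen_sub_mono_of_net_lt h1.le ((hle j hj).trans hb) ht (hnet j hj)
    simp only [val] at *
    linarith
  · exact (f.pen_pos i hi).trans_le (I.pen_mono_right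
      ((hle i (List.mem_cons_of_mem _ hi)).trans hb) (Nat.le_succ t) ht)
  · rw [f.h_eq i hi, I.highest_succ_of_lt ((hle i hi).trans hb) (hnet i hi)]

/-! ### The phases of one iteration. -/

section Phases

open CursorDeque

variable {x t : ℕ} {q : CursorDeque} {H : List ℕ} {h : ℕ → ℕ} {pot : ℕ → ℝ} {pred : ℕ → ℕ}
  {tb : Tables ℝ}

/-- Lines 7–11 when there is no cursor. -/
theorem reach_insert_off (v : I.Valid tb pot (t + 1)) (ht : h t = t) (L : List ℕ)
    (hlt : ∀ i ∈ L, i < t) (hkey : ∀ i ∈ L, I.key i < I.key t)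
    (hinc : L.reverse.Pairwise fun i j => i < j ∧ I.key i < I.key j)
    (hchain : L.Pairwise fun j i => i < j ∧ I.val j t ≤ I.val i t ∧ I.keyP i < I.keyP j)
    (hval : ∀ i ∈ L, I.val t t ≤ I.val i t)
    (hpen : ∀ i ∈ L, 0 < I.pen i t) (hh : ∀ i ∈ L, h i = I.highest i t)
    (hcov : I.Covers (t + 1) (L.reverse ++ [t])) :
    ∃ L', (∀ i ∈ L', i ∈ L) ∧ I.Queue t (t + 1) h t L' [] ∧
      I.Reach 25 ⟨.l7, t + 1, off L, H, h, pot, pred, tb⟩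
        ⟨.l12, t + 1, zip L' t [], H, h, pot, pred, tb⟩ := by
  obtain ⟨L', h1, h2, h3, h4⟩ := reach_prune (H := H) (h := h) (pred := pred) v (check := .l10)
    (body := .l11) (exit := .l12) (fun q => rfl) (fun q => rfl) (Nat.lt_succ_self t) [] L
    (fun i hi => (hlt i hi).trans (Nat.lt_succ_self t)) (hchain.imp fun h => h.2.2)
  refine ⟨L', fun i hi => h1.subset hi, ⟨?_, ?_, ⟨?_, fun i hi => hpen i (h1.subset hi), ?_⟩, ?_⟩, ?_⟩
  · simp only [List.append_nil, List.reverse_cons, List.pairwise_append, List.pairwise_singleton,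
      List.mem_reverse, List.mem_singleton, true_and]
    refine ⟨hinc.sublist h1.sublist.reverse, ?_⟩
    rintro i hi _ rfl
    exact ⟨hlt i (h1.subset hi), hkey i (h1.subset hi)⟩
  · simp only [List.append_nil, List.mem_reverse, List.forall_mem_cons]
    exact ⟨Nat.lt_succ_self t, fun i hi => (hlt i (h1.subset hi)).trans (Nat.lt_succ_self t)⟩
  · rw [List.pairwise_cons]
    exact ⟨fun i hi => ⟨hlt i (h1.subset hi), hval i (h1.subset hi), h2 i hi⟩,
      hchain.sublist h1.sublist⟩
  · rw [List.forall_mem_cons]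
    exact ⟨by rw [ht, I.highest_self], fun i hi => hh i (h1.subset hi)⟩
  · refine hcov.imp fun i hi => ?_
    simp only [List.mem_append, List.mem_reverse, List.mem_singleton] at hi
    rcases hi with hi | rfl
    · rcases h3 i hi with hi' | hi'
      · exact ⟨i, by simp [hi'], .refl I _ _⟩
      · exact ⟨t, by simp, fun y hy => I.supersedes_of_keyP_le (hlt i hi).le le_rfl hi'
          (hval i hi) y (by omega)⟩
    · exact ⟨i, by simp, .refl I _ _⟩
  · refine .cons (s' := ⟨.l8, t + 1, off (t :: L), H, h, pot, pred, tb⟩) (m := 13) ?_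
      (.cons (s' := ⟨.l9, t + 1, off (t :: L), H, h, pot, pred, tb⟩) (m := 12) ?_
      (.cons (s' := ⟨.l10, t + 1, zip L t [], H, h, pot, pred, tb⟩) ?_ h4 ?_) ?_) ?_
    · simp [step]
    · simp [step]
    · simp [step]
    · simp
      linarith
    · simp
    · simp
      linarith

/-- Lines 3–11. -/
theorem reach_insert (v : I.Valid tb pot (t + 1)) (ht : h t = t) {b : ℕ} {L R : List ℕ}
    (Q : I.Queue t t h b L R) :
    ∃ b' L' R', I.Queue t (t + 1) h b' L' R' ∧ (∀ i ∈ R', i ∈ R ∨ i = t) ∧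
      (∀ i ∈ (b' :: L').reverse ++ R', i ∈ (b :: L).reverse ++ R ∨ i = t) ∧
      I.Reach 30 ⟨.l3, t + 1, zip L b R, H, h, pot, pred, tb⟩
        ⟨.l12, t + 1, zip L' b' R', H, h, pot, pred, tb⟩ := by
  have e : ∀ R : List ℕ, L.reverse ++ b :: R = (b :: L).reverse ++ R := fun R => by simp
  have hb : b < t := Q.lt b (by simp)
  -- Whatever is dropped here has a key at least that of `t`, so the new element `t` takes over its
  -- role.
  have hcov : ∀ S : List ℕ, (∀ i ∈ (b :: L).reverse ++ R, i ∈ S ∨ I.key t ≤ I.key i) →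
      I.Covers (t + 1) (S ++ [t]) := fun S hS i hi => by
    rcases Nat.lt_succ_iff_lt_or_eq.1 hi with hi | rfl
    · obtain ⟨j, hj, hs⟩ := Q.covers i hi
      have hs' : I.Supersedes (t + 1) j i := fun y h1 h2 => hs y (by omega) h2
      rcases hS j hj with hj' | hj'
      · exact ⟨j, by simp [hj'], hs'⟩
      · exact ⟨t, by simp, (I.supersedes_of_key_le (Q.lt j hj).le (Nat.le_succ t) hj').trans hs'⟩
    · exact ⟨i, by simp, .refl I _ _⟩
  rcases reach_popBack (H := H) (h := h) (pred := pred) v (by omega) L b R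
    (by rw [e]; exact fun i hi => (Q.lt i hi).trans (Nat.lt_succ_self t)) (by rw [e]; exact Q.inc)
    with ⟨R', h1, h2, h3, h4⟩ | ⟨L', h1, h2, h3, h5, h4⟩
  · rw [e] at h2
    have hsub : ((b :: L).reverse ++ R').Sublist ((b :: L).reverse ++ R) :=
      (List.Sublist.refl _).append h1.sublist
    refine ⟨b, L, R' ++ [t], ⟨?_, ?_, Q.front, ?_⟩, fun i hi => ?_, fun i hi => ?_,
      h4.trans (m' := 25) ?_⟩
    · rw [← List.append_assoc, List.pairwise_append]
      refine ⟨Q.inc.sublist hsub, by simp, fun i hi j hj => ?_⟩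
      rw [List.mem_singleton] at hj
      rw [hj]
      exact ⟨Q.lt i (hsub.subset hi), h2 i hi⟩
    · intro i hi
      rw [← List.append_assoc, List.mem_append, List.mem_singleton] at hi
      rcases hi with hi | rfl
      · exact (Q.lt i (hsub.subset hi)).trans (Nat.lt_succ_self t)
      · exact Nat.lt_succ_self i
    · rw [← List.append_assoc]
      refine hcov _ fun i hi => ?_
      rw [List.mem_append] at hi ⊢
      rcases hi with hi | hi
      · exact .inl (.inl hi)
      · exact (h3 i hi).imp .inr id
    · rw [List.mem_append, List.mem_singleton] at hi
      exact hi.imp (fun hi => h1.subset hi) id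
    · rw [← List.append_assoc, List.mem_append, List.mem_singleton] at hi
      exact hi.imp (fun hi => hsub.subset hi) id
    · refine .cons (s' := ⟨.l8, t + 1, zip L b (R' ++ [t]), H, h, pot, pred, tb⟩) (m := 1) ?_
        (.single ?_ ?_) ?_
      · simp [step]
      · simp [step]
      · simp
      · simp
        linarith
  · have hs : L'.Sublist (b :: L) := h1.sublist.trans (List.sublist_cons_self _ _)
    have hbi : ∀ i ∈ L, I.val b t ≤ I.val i t := fun i hi =>
      ((List.pairwise_cons.1 Q.front.chain).1 i hi).2.1
    obtain ⟨L'', q1, q2, q3⟩ := reach_insert_off (H := H) (pred := pred) v ht L'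
      (fun i hi => Q.lt i (by simp [h1.subset hi])) h2
      ((List.pairwise_append.1 Q.inc).1.sublist hs.reverse) (Q.front.chain.sublist hs)
      -- The new element pays nothing at `t` and its key is at most that of the old cursor `b`,
      -- which was no worse than any element in front of it.
      (fun i hi => by
        refine le_trans ?_ (hbi i (h1.subset hi))
        have := I.pen_nonneg b t
        simp only [val, I.pen_self]
        simp only [Nat.add_sub_cancel] at h5
        linarith) (fun i hi => Q.front.pen_pos i (h1.subset hi))
      (fun i hi => Q.front.h_eq i (hs.subset hi))
      (hcov _ (by
        rw [e] at h3
        simpa using h3))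
    refine ⟨t, L'', [], q2, by simp, fun i hi => ?_, (h4.trans q3).mono (by norm_num)⟩
    simp only [List.append_nil, List.mem_reverse, List.mem_cons] at hi
    rcases hi with rfl | hi
    · exact .inr rfl
    · exact .inl (by simp [h1.subset (q1 i hi)])

/-- Lines 17–18. -/
theorem reach_absorb (v : I.Valid tb pot (t + 1)) (R : List ℕ) (L : List ℕ) :
    ∀ (b : ℕ) (h : ℕ → ℕ), (∀ i ∈ b :: L, i ≤ t) →
    ((b :: L).Pairwise fun j i => i < j ∧ I.val j t ≤ I.val i t ∧ I.keyP i < I.keyP j) →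
    h b = t + 1 → I.highest b (t + 1) = t + 1 → (∀ i ∈ L, h i = I.highest i t) →
    ∃ b' L' h', b' :: L' <:+ b :: L ∧ h' b' = t + 1 ∧ I.highest b' (t + 1) = t + 1 ∧
      (∀ i ∈ L', h' i = I.highest i t) ∧ (∀ a ∈ L'.head?, I.net (I.highest a t) < I.net (t + 1)) ∧
      (∀ i > t, h' i = h i) ∧ (∀ i ∈ b :: L, ∃ j ∈ b' :: L', I.Supersedes (t + 1) j i) ∧
      I.Reach 1 ⟨.l17, t + 1, zip L b R, H, h, pot, pred, tb⟩
        ⟨.l19, t + 1, zip L' b' R, H, h', pot, pred, tb⟩ := by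
  induction L with
  | nil =>
    intro b h _ _ hb hb' _
    exact ⟨b, [], h, List.suffix_rfl, hb, hb', by simp, by simp, fun _ _ => rfl,
      fun i hi => ⟨i, hi, .refl I _ _⟩, .single (by simp [step]) (by simp)⟩
  | cons a L ih =>
    intro b h hle hch hb hb' hL
    rw [List.forall_mem_cons] at hle hL
    have hat : a ≤ t := hle.2 a (by simp)
    obtain ⟨-, ha2, -⟩ := I.highest_spec hat
    have hda : dominatesH tb (h a) (t + 1) ↔ I.net (I.highest a t) < I.net (t + 1) := by
      rw [hL.1]
      exact v.dominatesH_iff (by omega) le_rfl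
    by_cases hd : I.net (I.highest a t) < I.net (t + 1)
    · refine ⟨b, a :: L, h, List.suffix_rfl, hb, hb', ?_, by simpa using hd, fun _ _ => rfl,
        fun i hi => ⟨i, hi, .refl I _ _⟩, .single ?_ (by simp)⟩
      · rwa [List.forall_mem_cons]
      · simp [step, hda, hd]
    · have hch' := List.pairwise_cons.1 hch
      have hch2 := List.pairwise_cons.1 hch'.2
      have hah := I.highest_succ_of_not_lt hat hd
      obtain ⟨b', L', h', r1, r2, r3, r4, r5, r6, r7, r8⟩ := ih a (Function.update h a (t + 1))
        hle.2 hch'.2 (by simp) hah (fun i hi => by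
          rw [Function.update_of_ne (hch2.1 i hi).1.ne, hL.2 i hi])
      refine ⟨b', L', h', r1.trans (List.suffix_cons _ _), r2, r3, r4, r5, fun i hi => ?_, ?_, ?_⟩
      · rw [r6 i hi, Function.update_of_ne (by omega)]
      · rw [List.forall_mem_cons]
        refine ⟨?_, r7⟩
        obtain ⟨j, hj, hs⟩ := r7 a (by simp)
        obtain ⟨k1, -, k3⟩ := hch'.1 a (by simp)
        -- The highest place of `a` is now `t + 1`, behind `b`, so the order of `keyP` settles the
        -- comparison in favour of `a`.
        exact ⟨j, hj, hs.trans (I.supersedes_of_le_highest k1.le (by omega)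
          (by rw [hah]; omega) k3.le)⟩
      · refine .cons (s' := ⟨.l18, t + 1, zip (a :: L) b R, H, h, pot, pred, tb⟩) (m := 0) ?_
          (.cons (s' := ⟨.l17, t + 1, zip L a R, H, Function.update h a (t + 1), pot, pred, tb⟩)
            ?_ r8 ?_) ?_
        · simp [step, hda, hd]
        · simp [step]
        · simp
          linarith
        · simp

/-- Lines 15–20. -/
theorem reach_update (v : I.Valid tb pot (t + 1)) {b : ℕ} {L R : List ℕ}
    (Q : I.Queue t (t + 1) h b L R) :
    ∃ b' L' h', I.Queue (t + 1) (t + 1) h' b' L' R ∧ b' :: L' <:+ b :: L ∧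
      (∀ i > t, h' i = h i) ∧
      I.Reach 10 ⟨.l15, t + 1, zip L b R, H, h, pot, pred, tb⟩
        ⟨.l21, t + 1, zip L' b' R, H, h', pot, pred, tb⟩ := by
  have hle : ∀ i ∈ b :: L, i ≤ t := fun i hi =>
    Nat.lt_succ_iff.1 (Q.lt i (List.mem_append_left _ (List.mem_reverse.2 hi)))
  have hbt := hle b (by simp)
  have hn := v.le
  have hhb := Q.front.h_eq b (by simp)
  obtain ⟨-, hb2, -⟩ := I.highest_spec hbt
  have hdb : dominatesH tb (h b) (t + 1) ↔ I.net (I.highest b t) < I.net (t + 1) := by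
    rw [hhb]
    exact v.dominatesH_iff (by omega) le_rfl
  by_cases hd : I.net (I.highest b t) < I.net (t + 1)
  · exact ⟨b, L, h, ⟨Q.inc, Q.lt, Q.front.succ hbt hn hd, Q.covers⟩, List.suffix_rfl,
      fun _ _ => rfl, .single (by simp [step, hdb, hd]) (by simp)⟩
  have hch := List.pairwise_cons.1 Q.front.chain
  obtain ⟨b', L', h', r1, r2, r3, r4, r5, r6, r7, r8⟩ := reach_absorb (H := H) (pred := pred) v R L
    b (Function.update h b (t + 1)) hle Q.front.chain (by simp) (I.highest_succ_of_not_lt hbt hd)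
    (fun i hi => by
      rw [Function.update_of_ne (hch.1 i hi).1.ne, Q.front.h_eq i (List.mem_cons_of_mem _ hi)])
  have hr : I.Reach 4 ⟨.l15, t + 1, zip L b R, H, h, pot, pred, tb⟩
      ⟨.l19, t + 1, zip L' b' R, H, h', pot, pred, tb⟩ := by
    refine .cons (s' := ⟨.l16, t + 1, zip L b R, H, h, pot, pred, tb⟩) (m := 3) ?_
      (.cons (s' := ⟨.l17, t + 1, zip L b R, H, Function.update h b (t + 1), pot, pred, tb⟩)
        ?_ r8 ?_) ?_
    · simp [step, hdb, hd]
    · simp [step]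
    · simp
    · simp
  have h6 : ∀ i > t, h' i = h i := fun i hi => by
    rw [r6 i hi, Function.update_of_ne (by omega)]
  -- `h'` is already advanced at `b'`; with that entry reset, the invariant for node `t` is
  -- available for the shortened list.
  have hF : I.Front t (Function.update h' b' (I.highest b' t)) b' L' := by
    have f := Q.front.sublist r1
    have hc := List.pairwise_cons.1 f.chain
    refine ⟨f.chain, f.pen_pos, ?_⟩
    rw [List.forall_mem_cons]
    refine ⟨by simp, fun i hi => ?_⟩
    rw [Function.update_of_ne (hc.1 i hi).1.ne, r4 i hi]
  have hb't : b' ≤ t := hle b' (r1.subset (by simp))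

  have hQ : ∀ b'' L'', b'' :: L'' <:+ b' :: L' → I.Front (t + 1) h' b'' L'' →
      (∀ i ∈ b' :: L', ∃ j ∈ b'' :: L'', I.Supersedes (t + 1) j i) →
      I.Queue (t + 1) (t + 1) h' b'' L'' R := fun b'' L'' hs hf hcov => by
    have hsub : ((b'' :: L'').reverse ++ R).Sublist ((b :: L).reverse ++ R) :=
      (hs.trans r1).sublist.reverse.append (List.Sublist.refl _)
    refine ⟨Q.inc.sublist hsub, fun i hi => Q.lt i (hsub.subset hi), hf,
      Q.covers.imp fun i hi => ?_⟩
    rw [List.mem_append, List.mem_reverse] at hi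
    rcases hi with hi | hi
    · obtain ⟨j, hj, hs⟩ := r7 i hi
      obtain ⟨k, hk, hs'⟩ := hcov j hj
      exact ⟨k, List.mem_append_left _ (List.mem_reverse.2 hk), hs'.trans hs⟩
    · exact ⟨i, List.mem_append_right _ hi, .refl I _ _⟩
  cases L' with
  | nil =>
    refine ⟨b', [], h', hQ b' [] List.suffix_rfl ⟨by simp, by simp, by simp [r2, r3]⟩
      fun i hi => ⟨i, hi, .refl I _ _⟩, r1, h6, ?_⟩
    refine (hr.trans (m' := 1) (.single ?_ ?_)).mono (by norm_num)
    · simp [step]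
    · simp
  | cons a L' =>
    have hat : a ≤ t := hle a (r1.subset (by simp))
    have hna : I.net (I.highest a t) < I.net (t + 1) := r5 a (by simp)
    have hc := List.pairwise_cons.1 hF.chain
    obtain ⟨hab, hvab, hPab⟩ := hc.1 a (by simp)
    -- The highest place of `a` has not moved, so everything from `a` forward is already in order at
    -- `t + 1`. Only `b'` and `a` remain to be compared, which is why a single test suffices.
    have hFa : I.Front (t + 1) h' a L' := by
      refine Front.succ ⟨hc.2, fun i hi => hF.pen_pos i (by simp [hi]), r4⟩ hat hn hna
    have hha : h' a = I.highest a (t + 1) := hFa.h_eq a (by simp)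
    have hdA := v.dominatesA_iff (i := a) (k := b') (by omega) (by omega) hha (r2.trans r3.symm)
    by_cases hlt : I.val a (t + 1) < I.val b' (t + 1)
    -- If `b'` paid nothing at `t + 1`, the gap would have moved in its favour since `t`, and `a`
    -- could not have overtaken it.
    · have hpos : 0 < I.pen b' (t + 1) := by
        by_contra hc
        have := I.pen_sub_mono_of_pen_eq_zero hab.le hb't (Nat.le_succ t) hn
          (le_antisymm (not_lt.1 hc) (I.pen_nonneg _ _))
        simp only [val, Nat.succ_eq_add_one] at *
        linarith
      refine ⟨a, L', h', hQ a L' (List.suffix_cons _ _) hFa ?_, (List.suffix_cons _ _).trans r1,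
        h6, ?_⟩
      · rw [List.forall_mem_cons]
        exact ⟨⟨a, by simp, I.supersedes_of_pen_pos hab.le (by omega) hpos hlt.le⟩,
          fun i hi => ⟨i, hi, .refl I _ _⟩⟩
      · refine (hr.trans (m' := 2) (.cons (m := 1)
          (s' := ⟨.l20, t + 1, zip (a :: L') b' R, H, h', pot, pred, tb⟩) ?_
          (.single ?_ ?_) ?_)).mono (by norm_num)
        · simp [step, hdA, hlt]
        · simp [step]
        · simp
        · simp
    · refine ⟨b', a :: L', h', hQ b' (a :: L') List.suffix_rfl ⟨?_, ?_, ?_⟩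
        fun i hi => ⟨i, hi, .refl I _ _⟩, r1, h6, ?_⟩
      · have hcA := List.pairwise_cons.1 hFa.chain
        rw [List.pairwise_cons]
        refine ⟨fun i hi => ⟨(hc.1 i hi).1, (not_lt.1 hlt).trans ?_, (hc.1 i hi).2.2⟩, hFa.chain⟩
        rcases List.mem_cons.1 hi with rfl | hi
        · exact le_rfl
        · exact (hcA.1 i hi).2.1
      · rw [List.forall_mem_cons]
        exact ⟨(hF.pen_pos a (by simp)).trans_le (I.pen_mono_right hat (Nat.le_succ t) hn),
          hFa.pen_pos⟩
      · rw [List.forall_mem_cons]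
        exact ⟨r2.trans r3.symm, hFa.h_eq⟩
      · refine (hr.trans (m' := 1) (.single ?_ ?_)).mono (by norm_num)
        · simp [step, hdA, hlt]
        · simp

/-- Moving the cursor to the next element, followed by the removal of elements in front of it. -/
theorem reach_moveNext (v : I.Valid tb pot x) {check body exit : Line} {b r : ℕ} {L R : List ℕ}
    (Q : I.Queue x x h b L (r :: R))
    (hcheck : ∀ q h, I.step ⟨check, x, q, H, h, pot, pred, tb⟩ = match q.prev? with
      | some a => q.best?.bind fun b =>
        if I.dominatesP tb pot a b then some ⟨exit, x, q, H, h, pot, pred, tb⟩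
        else some ⟨body, x, q, H, h, pot, pred, tb⟩
      | none => some ⟨exit, x, q, H, h, pot, pred, tb⟩)
    (hbody : ∀ q h, I.step ⟨body, x, q, H, h, pot, pred, tb⟩
      = some ⟨check, x, q.removePrev, H, h, pot, pred, tb⟩)
    (hval : I.val r x ≤ I.val b x) (hpen : 0 < I.pen b x) :
    ∃ L' h', I.Queue x x h' r L' R ∧ (∀ i ≥ x, h' i = h i) ∧ L' <:+ b :: L ∧
      I.Reach 1 ⟨check, x, zip (b :: L) r R, H, Function.update h r (I.highest r x), pot, pred, tb⟩
        ⟨exit, x, zip L' r R, H, h', pot, pred, tb⟩ := by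
  have hch := List.pairwise_cons.1 Q.front.chain
  have hrx : r < x := Q.lt r (by simp)
  have hlr : ∀ i ∈ b :: L, i < r := fun i hi =>
    ((List.pairwise_append.1 Q.inc).2.2 i (List.mem_reverse.2 hi) r (by simp)).1
  have hv : ∀ i ∈ b :: L, I.val r x ≤ I.val i x := by
    rw [List.forall_mem_cons]
    exact ⟨hval, fun i hi => hval.trans (hch.1 i hi).2.1⟩
  obtain ⟨L', h1, h2, h3, h4⟩ := reach_prune (H := H) (pred := pred)
    (h := Function.update h r (I.highest r x)) v (check := check) (body := body) (exit := exit)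
    (fun q => hcheck q _) (fun q => hbody q _) hrx R (b :: L) (fun i hi => (hlr i hi).trans hrx)
    (Q.front.chain.imp fun h => h.2.2)
  have hsub : ((r :: L').reverse ++ R).Sublist ((b :: L).reverse ++ r :: R) := by
    have : (r :: L').reverse ++ R = L'.reverse ++ r :: R := by simp
    rw [this]
    exact h1.sublist.reverse.append (List.Sublist.refl _)
  refine ⟨L', Function.update h r (I.highest r x), ⟨Q.inc.sublist hsub,
    fun i hi => Q.lt i (hsub.subset hi), ⟨?_, ?_, ?_⟩, Q.covers.imp fun i hi => ?_⟩,
    fun i hi => Function.update_of_ne (by omega) _ _, h1, h4⟩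
  · rw [List.pairwise_cons]
    exact ⟨fun i hi => ⟨hlr i (h1.subset hi), hv i (h1.subset hi), h2 i hi⟩,
      Q.front.chain.sublist h1.sublist⟩
  · intro i hi
    rcases List.mem_cons.1 (h1.subset hi) with rfl | hi
    · exact hpen
    · exact Q.front.pen_pos i hi
  · rw [List.forall_mem_cons]
    refine ⟨by simp, fun i hi => ?_⟩
    rw [Function.update_of_ne (hlr i (h1.subset hi)).ne, Q.front.h_eq i (h1.subset hi)]
  · rw [List.mem_append, List.mem_reverse, List.mem_cons (a := i) (b := r)] at hi
    rcases hi with hi | rfl | hi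
    · rcases h3 i hi with hi' | hi'
      · exact ⟨i, by simp [hi'], .refl I _ _⟩
      · exact ⟨r, by simp, I.supersedes_of_keyP_le (hlr i hi).le hrx.le hi' (hv i hi)⟩
    · exact ⟨i, by simp, .refl I _ _⟩
    · exact ⟨i, by simp [hi], .refl I _ _⟩

/-- Records for the element behind the cursor, if there is one. -/
def Ready (I : Instance ℝ n) (x : ℕ) (R H : List ℕ) : Prop :=
  ∃ lo ≤ x, I.Records x lo H ∧ (∀ r ∈ R, lo ≤ r) ∧ ∀ r ∈ R.head?, lo = r

/-- Lines 21–23 and lines 31–33. -/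
theorem reach_ready {test check body exit : Line} {lo b : ℕ} {L R : List ℕ} (hlo : lo ≤ x)
    (hr : I.Records x lo H)
    (htest : ∀ q H, I.step ⟨test, x, q, H, h, pot, pred, tb⟩ = if q.next?.isSome
      then some ⟨check, x, q, H, h, pot, pred, tb⟩ else some ⟨exit, x, q, H, h, pot, pred, tb⟩)
    (hcheck : ∀ q H, I.step ⟨check, x, q, H, h, pot, pred, tb⟩ =
      H.head?.bind fun f => q.next?.bind fun a =>
        if f < a then some ⟨body, x, q, H, h, pot, pred, tb⟩
        else some ⟨exit, x, q, H, h, pot, pred, tb⟩)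
    (hbody : ∀ q H, I.step ⟨body, x, q, H, h, pot, pred, tb⟩
      = some ⟨check, x, q, H.tail, h, pot, pred, tb⟩)
    (hR : R.Pairwise (· < ·)) (hlt : ∀ r ∈ R, lo ≤ r ∧ r ≤ x) :
    ∃ H', I.Ready x R H' ∧ I.Reach 2 ⟨test, x, zip L b R, H, h, pot, pred, tb⟩
      ⟨exit, x, zip L b R, H', h, pot, pred, tb⟩ := by
  cases R with
  | nil =>
    refine ⟨H, ⟨lo, hlo, hr, by simp, by simp⟩, .single ?_ (by simp)⟩
    rw [htest]
    simp
  | cons r R =>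
    obtain ⟨hlr, hrx⟩ := hlt r (by simp)
    refine ⟨H.filter fun z => r ≤ z, ⟨r, hrx, hr.filter hlr, ?_, by simp⟩, .cons ?_
      (reach_dropH (fun H => hcheck _ H) (fun H => hbody _ H) (zip_cons_next? L r b R) H
        ⟨_, hr.highest_mem hlr hrx, (I.highest_spec hrx).1⟩ hr.sorted) (by simp)⟩
    · rw [List.forall_mem_cons]
      exact ⟨le_rfl, fun i hi => ((List.pairwise_cons.1 hR).1 i hi).le⟩
    · rw [htest]
      simp

theorem Queue.pairwise_right {t N b : ℕ} {L R : List ℕ} (Q : I.Queue t N h b L R) :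
    R.Pairwise (· < ·) :=
  ((List.pairwise_append.1 Q.inc).2.1).imp And.left

theorem Queue.right_lt {t N b : ℕ} {L R : List ℕ} (Q : I.Queue t N h b L R) {r : ℕ}
    (hr : r ∈ R) : b < r ∧ I.key b < I.key r ∧ r < N :=
  have := (List.pairwise_append.1 Q.inc).2.2 b (by simp) r hr
  ⟨this.1, this.2, Q.lt r (List.mem_append_right _ hr)⟩

/-- Lines 24–33. -/
theorem reach_penalized (v : I.Valid tb pot x) (R : List ℕ) :
    ∀ (b : ℕ) (L H : List ℕ) (h : ℕ → ℕ), I.Queue x x h b L R → I.Ready x R H →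
    ∃ b' L' R' H' h', I.Queue x x h' b' L' R' ∧ I.Ready x R' H' ∧ (∀ i ≥ x, h' i = h i) ∧
      (∀ i ∈ (b' :: L').reverse ++ R', i ∈ (b :: L).reverse ++ R) ∧
      (∀ r ∈ R', I.pen r x = 0) ∧
      I.Reach 1 ⟨.l24, x, zip L b R, H, h, pot, pred, tb⟩
        ⟨.l34, x, zip L' b' R', H', h', pot, pred, tb⟩ := by
  induction R with
  | nil =>
    intro b L H h Q hH
    exact ⟨b, L, [], H, h, Q, hH, fun _ _ => rfl, fun _ hi => hi, by simp,
      .single (by simp [step]) (by simp)⟩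
  | cons r R ih =>
    intro b L H h Q ⟨lo, hlo, hr, hlow, hhead⟩
    obtain rfl : lo = r := hhead r (by simp)
    obtain ⟨hbr, hkey, hrx⟩ := Q.right_lt (r := lo) (by simp)
    have hbx : b < x := hbr.trans hrx
    have hH := hr.head?_eq hlo
    have hpa := v.penAt_eq (i := lo) hlo rfl
    have hpw := List.pairwise_cons.1 Q.pairwise_right
    have hready : ∀ r' ∈ R, lo ≤ r' ∧ r' ≤ x := fun r' hr' =>
      ⟨hlow r' (by simp [hr']), (Q.right_lt (r := r') (by simp [hr'])).2.2.le⟩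
    by_cases hp : 0 < I.pen lo x
    · have hdA := v.dominatesA_iff (i := b) (k := lo) hbx hrx (Q.front.h_eq b (by simp)) rfl
      by_cases hd : I.val b x < I.val lo x
      · have hsub : ((b :: L).reverse ++ R).Sublist ((b :: L).reverse ++ lo :: R) :=
          (List.Sublist.refl _).append (List.sublist_cons_self _ _)
        have Q' : I.Queue x x h b L R := by
          refine ⟨Q.inc.sublist hsub, fun i hi => Q.lt i (hsub.subset hi), Q.front,
            Q.covers.imp fun i hi => ?_⟩
          rw [List.mem_append, List.mem_cons (a := i) (b := lo)] at hi
          rcases hi with hi | rfl | hi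
          · exact ⟨i, List.mem_append_left _ hi, .refl I _ _⟩
          -- A penalized element that is worse than the cursor in front of it can never catch up.
          · exact ⟨b, by simp, I.supersedes_of_pen_pos hbr.le hrx.le hp hd.le⟩
          · exact ⟨i, List.mem_append_right _ hi, .refl I _ _⟩
        obtain ⟨H₁, hH₁, hR₁⟩ := reach_ready (I := I) (h := h) (pot := pot) (pred := pred)
          (tb := tb) (test := .l31) (check := .l32) (body := .l33) (exit := .l24) (b := b) (L := L)
          hlo hr (fun _ _ => rfl) (fun _ _ => rfl) (fun _ _ => rfl) hpw.2 hready
        obtain ⟨b', L', R', H', h', k1, k2, k3, k4, k5, k6⟩ := ih b L H₁ h Q' hH₁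
        refine ⟨b', L', R', H', h', k1, k2, k3, fun i hi => hsub.subset (k4 i hi), k5, ?_⟩
        refine .cons (s' := ⟨.l25, x, zip L b (lo :: R), H, h, pot, pred, tb⟩) (m := 0) ?_
          (.cons (s' := ⟨.l26, x, zip L b (lo :: R), H, h, pot, pred, tb⟩) (m := -1) ?_
          (.cons (s' := ⟨.l31, x, zip L b R, H, h, pot, pred, tb⟩) ?_ (hR₁.trans k6) ?_) ?_) ?_
        · simp [step, hH, hpa, hp]
        · simp [step, hH, hdA, hd]
        · simp [step]
        · simp
          linarith
        · simp
        · simp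
      · obtain ⟨L₁, h₁, Q₁, p1, p2, p3⟩ := reach_moveNext (H := H) (pred := pred) v
          (check := .l29) (body := .l30) (exit := .l31) Q (fun _ _ => rfl) (fun _ _ => rfl)
          (not_lt.1 hd) (hp.trans_le (I.pen_anti_left hbr.le hrx.le v.le))
        obtain ⟨H₁, hH₁, hR₁⟩ := reach_ready (I := I) (h := h₁) (pot := pot) (pred := pred)
          (tb := tb) (test := .l31) (check := .l32) (body := .l33) (exit := .l24) (b := lo)
          (L := L₁) hlo hr (fun _ _ => rfl) (fun _ _ => rfl) (fun _ _ => rfl) hpw.2 hready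
        obtain ⟨b', L', R', H', h', k1, k2, k3, k4, k5, k6⟩ := ih lo L₁ H₁ h₁ Q₁ hH₁
        refine ⟨b', L', R', H', h', k1, k2, fun i hi => (k3 i hi).trans (p1 i hi),
          fun i hi => ?_, k5, ?_⟩
        · have := k4 i hi
          simp only [List.mem_append, List.mem_reverse, List.mem_cons] at this ⊢
          rcases this with (h | h) | h
          · exact .inr (.inl h)
          · exact .inl (List.mem_cons.1 (p2.subset h))
          · exact .inr (.inr h)
        · refine .cons (s' := ⟨.l25, x, zip L b (lo :: R), H, h, pot, pred, tb⟩) (m := 0) ?_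
            (.cons (s' := ⟨.l28, x, zip L b (lo :: R), H, h, pot, pred, tb⟩) (m := -1) ?_
            (.cons (s' := ⟨.l29, x, zip (b :: L) lo R, H,
              Function.update h lo (I.highest lo x), pot, pred, tb⟩) ?_
              (p3.trans (hR₁.trans k6)) ?_) ?_) ?_
          · simp [step, hH, hpa, hp]
          · simp [step, hH, hdA, hd]
          · simp [step, hH]
          · simp
            linarith
          · simp
          · simp
    · refine ⟨b, L, lo :: R, H, h, Q, ⟨lo, hlo, hr, hlow, hhead⟩, fun _ _ => rfl,
        fun _ hi => hi, ?_, .single ?_ (by simp)⟩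
      -- Later starts pay no more, so the first free element shows that all those behind it are
      -- free.
      · have h0 : ∀ r' ∈ lo :: R, lo ≤ r' := hlow
        intro r' hr'
        exact le_antisymm ((I.pen_anti_left (h0 r' hr') (Q.right_lt hr').2.2.le v.le).trans
          (not_lt.1 hp)) (I.pen_nonneg _ _)
      · simp [step, hH, hpa, hp]

/-- Lines 34–37. -/
theorem reach_last (v : I.Valid tb pot x) {b : ℕ} {L R : List ℕ} (Q : I.Queue x x h b L R)
    (hH : I.Ready x R H) (hR : ∀ r ∈ R, I.pen r x = 0) :
    ∃ b' L' R' h', I.Queue x x h' b' L' R' ∧ R' <:+ R ∧ (∀ i ≥ x, h' i = h i) ∧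
      (∀ i ∈ (b' :: L').reverse ++ R', i ∈ (b :: L).reverse ++ R) ∧
      (∀ r ∈ R'.head?, I.val b' x < I.val r x) ∧
      I.Reach 10 ⟨.l34, x, zip L b R, H, h, pot, pred, tb⟩
        ⟨.l38, x, zip L' b' R', H, h', pot, pred, tb⟩ := by
  cases R with
  | nil =>
    exact ⟨b, L, [], h, Q, List.suffix_rfl, fun _ _ => rfl, fun _ hi => hi, by simp,
      .single (by simp [step]) (by simp)⟩
  | cons r R =>
    obtain ⟨lo, hlo, hr, hlow, hhead⟩ := hH
    obtain rfl : lo = r := hhead r (by simp)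
    obtain ⟨hbr, hkey, hrx⟩ := Q.right_lt (r := lo) (by simp)
    have hH := hr.head?_eq hlo
    have hdA := v.dominatesA_iff (i := b) (k := lo) (hbr.trans hrx) hrx
      (Q.front.h_eq b (by simp)) rfl
    by_cases hd : I.val b x < I.val lo x
    · exact ⟨b, L, lo :: R, h, Q, List.suffix_rfl, fun _ _ => rfl, fun _ hi => hi, by simpa using hd,
        .single (by simp [step, hH, hdA, hd]) (by simp)⟩
    · have h0 := hR lo (by simp)
      -- The cursor has the smaller key and is still no better than an unpenalized element, so it
      -- must be paying.
      have hpos : 0 < I.pen b x := by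
        simp only [val, h0] at hd
        linarith
      obtain ⟨L₁, h₁, Q₁, p1, p2, p3⟩ := reach_moveNext (H := H) (pred := pred) v
        (check := .l36) (body := .l37) (exit := .l38) Q (fun _ _ => rfl) (fun _ _ => rfl)
        (not_lt.1 hd) hpos
      refine ⟨lo, L₁, R, h₁, Q₁, List.suffix_cons _ _, p1, fun i hi => ?_, fun r hr' => ?_, ?_⟩
      · simp only [List.mem_append, List.mem_reverse, List.mem_cons] at hi ⊢
        rcases hi with (h | h) | h
        · exact .inr (.inl h)
        · exact .inl (List.mem_cons.1 (p2.subset h))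
        · exact .inr (.inr h)
      -- The next element is also free and has a larger key, hence is strictly worse: a single move
      -- of the cursor suffices.
      · have hm : r ∈ R := List.mem_of_mem_head? hr'
        have := (Q₁.right_lt hm).2.1
        simp only [val, h0, hR r (by simp [hm])]
        linarith
      · refine .cons (s' := ⟨.l35, x, zip L b (lo :: R), H, h, pot, pred, tb⟩) (m := 9) ?_
          (.cons (s' := ⟨.l36, x, zip (b :: L) lo R, H,
            Function.update h lo (I.highest lo x), pot, pred, tb⟩) ?_ p3 ?_) ?_
        · simp [step, hH, hdA, hd]
        · simp [step, hH]
        · simp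
          linarith
        · simp

end Phases

end Instance

end SoftVRPSPD

/-! ### Control flow, and uniqueness of the visit to `l38`. -/

namespace SoftVRPSPD

/-- The line belongs to the body of the main loop. -/
def Line.inner : Line → Bool
  | .pre | .l1 | .l2 | .done => false
  | _ => true

/-- A quantity that never decreases. -/
def State.rank {K : Type} (s : State K) : ℕ :=
  match s.line with
  | .pre | .l1 => 0
  | .l2 | .done => 2 * s.x + 2
  | _ => 2 * s.x + 1

namespace Instance

variable {n : ℕ} {I : Instance ℝ n}

theorem step_cases {s s' : State ℝ} (h : I.step s = some s') :
    (s.line.inner = true ∧ s'.x = s.x ∧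
      (s.line ≠ .l38 ∧ s'.line.inner = true ∨ s.line = .l38 ∧ s'.line = .l2)) ∨
    ((s.line = .pre ∨ s.line = .l1) ∧ s'.line.inner = false) ∨
    (s.line = .l2 ∧ (s'.line = .l3 ∧ s'.x = s.x + 1 ∧ s.x < n ∨ s'.line = .done ∧ s'.x = s.x)) := by
  obtain ⟨line, x, q, H, h', pot, pred, tb⟩ := s
  cases line <;> simp only [step, Option.bind_eq_bind, Option.bind_eq_some_iff] at h <;>
    (repeat' split at h) <;>
    (try simp only [Option.some.injEq, Option.bind_eq_some_iff, reduceCtorEq] at h) <;>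
    grind [Line.inner]

theorem rank_of_inner {s : State ℝ} (h : s.line.inner = true) : s.rank = 2 * s.x + 1 := by
  obtain ⟨line, x, q, H, h', pot, pred, tb⟩ := s
  cases line <;> first | rfl | cases h

theorem rank_le {s s' : State ℝ} (h : I.step s = some s') :
    s.rank ≤ s'.rank ∧ (s.line = .l38 → s.rank < s'.rank) := by
  rcases step_cases h with ⟨h1, h2, ⟨h3, h4⟩ | ⟨h3, h4⟩⟩ | ⟨h1 | h1, h2⟩ |
    ⟨h1, ⟨h2, h3, h4⟩ | ⟨h2, h3⟩⟩
  · rw [rank_of_inner h1, rank_of_inner h4, h2]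
    exact ⟨le_rfl, fun h => absurd h h3⟩
  · have : s'.rank = 2 * s'.x + 2 := by simp [State.rank, h4]
    rw [rank_of_inner h1, this, h2]
    omega
  · have : s.rank = 0 := by simp [State.rank, h1]
    simp [h1, this]
  · have : s.rank = 0 := by simp [State.rank, h1]
    simp [h1, this]
  · simp only [State.rank, h1, h2, h3, reduceCtorEq, false_imp_iff, and_true]
    omega
  · simp [State.rank, h1, h2, h3]

theorem run_rank_le {t : ℕ} {s : State ℝ} (h : I.run t = some s) (k : ℕ) {s' : State ℝ}
    (h' : I.run (t + k) = some s') : s.rank ≤ s'.rank := by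
  induction k generalizing s' with
  | zero =>
    rw [Nat.add_zero, h] at h'
    rw [Option.some.inj h']
  | succ k ih =>
    rw [← Nat.add_assoc, run, Option.bind_eq_some_iff] at h'
    obtain ⟨r, h1, h2⟩ := h'
    exact (ih h1).trans (rank_le h2).1

/-- The step out of `l38` raises the rank strictly and no step lowers it, while at `l38` the rank is
a function of `x`. -/
theorem not_atLine38_of_lt {t t' : ℕ} {s s' : State ℝ} (h : I.AtLine38 t s)
    (h' : I.AtLine38 t' s') (hx : s.x = s'.x) : ¬ t < t' := fun hlt => by
  obtain ⟨k, rfl⟩ := Nat.exists_eq_add_of_lt hlt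
  obtain ⟨r, hr⟩ : ∃ r, I.run (t + 1) = some r := by
    by_contra hc
    have hnone : I.run (t + 1) = none := by
      cases e : I.run (t + 1) with
      | none => rfl
      | some r => exact absurd ⟨r, e⟩ hc
    have : ∀ k, I.run (t + 1 + k) = none := fun k => by
      induction k with
      | zero => exact hnone
      | succ k ih => rw [← Nat.add_assoc, run, ih, Option.bind_none]
    have h2 := h'.1
    rw [Nat.add_right_comm, this] at h2
    cases h2
  have h1 : s.rank < r.rank := by
    have hr' := hr
    rw [run, h.1, Option.bind_some] at hr'
    exact (rank_le hr').2 h.2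
  have h2 := run_rank_le hr k (s' := s') (by rw [Nat.add_right_comm]; exact h'.1)
  have h3 : s.rank = s'.rank := by simp [State.rank, h.2, h'.2, hx]
  omega

theorem AtLine38.eq_of_x_eq {t t' : ℕ} {s s' : State ℝ} (h : I.AtLine38 t s)
    (h' : I.AtLine38 t' s') (hx : s.x = s'.x) : t = t' ∧ s = s' := by
  have ht : t = t' := le_antisymm (not_lt.1 (not_atLine38_of_lt h' h hx.symm))
    (not_lt.1 (not_atLine38_of_lt h h' hx))
  subst ht
  exact ⟨rfl, Option.some.inj (h.1.symm.trans h'.1)⟩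

theorem run_range {t : ℕ} {s : State ℝ} (h : I.run t = some s) :
    s.line.inner = true → 1 ≤ s.x ∧ s.x ≤ n := by
  induction t generalizing s with
  | zero =>
    rw [run, Option.some.injEq] at h
    subst h
    simp [State.init, Line.inner]
  | succ t ih =>
    rw [run, Option.bind_eq_some_iff] at h
    obtain ⟨r, h1, h2⟩ := h
    have := ih h1
    intro hs
    rcases step_cases h2 with ⟨a, b, _⟩ | ⟨_, b⟩ | ⟨_, ⟨_, b, c⟩ | ⟨b, _⟩⟩
    · rw [b]
      exact this a
    · simp [hs] at b
    · omega
    · simp [b, Line.inner] at hs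

/-! ### One complete iteration, and the whole run. -/

open CursorDeque

variable (I) in
/-- The situation at line 38. -/
structure Settled (x : ℕ) (s : State ℝ) (b : ℕ) (L R : List ℕ) : Prop where
  line_eq : s.line = .l38
  x_eq : s.x = x
  valid : I.Valid s.tables s.pot x
  queue_eq : s.queue = zip L b R
  queue : I.Queue x x s.h b L R
  pen_eq_zero : ∀ r ∈ R, I.pen r x = 0
  val_lt : ∀ r ∈ R.head?, I.val b x < I.val r x

variable (I) in
/-- The situation at line 2 after `t` iterations. -/
structure Between (t : ℕ) (s : State ℝ) : Prop where
  line_eq : s.line = .l2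
  x_eq : s.x = t
  valid : I.Valid s.tables s.pot t
  pot_eq : s.pot t = I.minDist t
  h_eq : ∀ i, t ≤ i → i ≤ n → s.h i = i
  queue : (t = 0 ∧ s.queue = off [] ∨ ∃ b L R, s.queue = zip L b R ∧ I.Queue t t s.h b L R ∧
    ∃ lo ≤ t, I.Records t lo s.queueH ∧ ∀ r ∈ R, lo ≤ r)
  records : ∃ lo ≤ t, I.Records t lo s.queueH

/-- It suffices to compare the cursor with the elements of the queue, by `Covers`. Those in front
are handled by the chain of `Front`; those behind pay nothing and are ordered by key, so only the
first of them matters. -/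
theorem Settled.val_le {x : ℕ} {s : State ℝ} {b : ℕ} {L R : List ℕ} (S : I.Settled x s b L R)
    {i : ℕ} (hi : i < x) : I.val b x ≤ I.val i x := by
  obtain ⟨j, hj, hs⟩ := S.queue.covers i hi
  refine le_trans ?_ (hs x le_rfl S.valid.le)
  rw [List.mem_append, List.mem_reverse, List.mem_cons] at hj
  rcases hj with (rfl | hj) | hj
  · exact le_rfl
  · exact ((List.pairwise_cons.1 S.queue.front.chain).1 j hj).2.1
  · have h0 := S.pen_eq_zero
    have hlt := S.val_lt
    have hinc := (List.pairwise_append.1 S.queue.inc).2.1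
    cases R with
    | nil => simp at hj
    | cons r R =>
      have hr := hlt r (by simp)
      rcases List.mem_cons.1 hj with rfl | hj'
      · exact hr.le
      · have := ((List.pairwise_cons.1 hinc).1 j hj').2
        simp only [val, h0 j hj, h0 r (by simp)] at *
        linarith

theorem Settled.minDist_eq {x : ℕ} {s : State ℝ} {b : ℕ} {L R : List ℕ}
    (S : I.Settled x s b L R) (hx : 0 < x) :
    b < x ∧ I.minDist b + I.arcCost b x = I.minDist x := by
  have hb : b < x := S.queue.lt b (by simp)
  refine ⟨hb, le_antisymm ?_ (I.minDist_le hb)⟩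
  obtain ⟨i, hi, he⟩ := I.exists_minDist_eq hx
  rw [he, I.minDist_add_arcCost hb, I.minDist_add_arcCost hi]
  linarith [S.val_le hi]

theorem reach_window {t : ℕ} {q : CursorDeque} {H : List ℕ} {h : ℕ → ℕ} {pot : ℕ → ℝ}
    {pred : ℕ → ℕ} {tb : Tables ℝ} (v : I.Valid tb pot (t + 1)) {lo : ℕ} (hlo : lo ≤ t)
    (r : I.Records t lo H) :
    ∃ H', I.Records (t + 1) lo H' ∧ I.Reach 10 ⟨.l12, t + 1, q, H, h, pot, pred, tb⟩
      ⟨.l15, t + 1, q, H', h, pot, pred, tb⟩ := by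
  refine ⟨_, r.succ hlo, ((reach_popH v H (fun z hz => ?_) r.pairwise_net).trans (m' := 6)
    (.single rfl ?_)).mono (by norm_num)⟩
  · have := ((r.mem_iff z).1 hz).2.1
    omega
  · simp [State.credit]
    linarith

/-- One iteration of the main loop. -/
theorem reach_iteration {t : ℕ} {s : State ℝ} (B : I.Between t s) (ht : t < n) :
    ∃ r b L R s', I.Settled (t + 1) r b L R ∧ I.Reach 99 s r ∧ I.step r = some s' ∧
      s'.credit = r.credit ∧ I.Between (t + 1) s' ∧ s'.queue = r.queue ∧
      s'.pred = Function.update s.pred (t + 1) b ∧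
      ∀ i ∈ r.queue.items, i ∈ s.queue.items ∨ i = t := by
  obtain ⟨line, x, q, H, h, pot, pred, tb⟩ := s
  obtain ⟨rfl, rfl, v₀, hpot, hh, hq, hrec⟩ := B
  simp only at v₀ hpot hh hq hrec ⊢
  have v : I.Valid tb pot (x + 1) := ⟨ht, v₀.C_eq, v₀.D_eq, v₀.P_eq, fun i hi => by
    rcases Nat.lt_succ_iff_lt_or_eq.1 hi with hi | rfl
    · exact v₀.pot_eq i hi
    · exact hpot⟩
  have h1 : ∃ b L R lo, I.Queue x (x + 1) h b L R ∧ lo ≤ x ∧ I.Records x lo H ∧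
      (∀ r ∈ R, lo ≤ r) ∧ (∀ i ∈ (b :: L).reverse ++ R, i ∈ q.items ∨ i = x) ∧
      I.Reach 30 ⟨.l3, x + 1, q, H, h, pot, pred, tb⟩
        ⟨.l12, x + 1, zip L b R, H, h, pot, pred, tb⟩ := by
    rcases hq with ⟨rfl, rfl⟩ | ⟨b, L, R, rfl, Q, lo, hlo, hr, hR⟩
    · obtain ⟨lo, hlo, hr⟩ := hrec
      obtain ⟨L', q1, q2, q3⟩ := reach_insert_off (H := H) (pred := pred) v (hh 0 le_rfl ht.le) []
        (by simp) (by simp) (by simp) (by simp) (by simp) (by simp) (by simp)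
        (fun i hi => ⟨0, by simp, by
          obtain rfl : i = 0 := by omega
          exact .refl I _ _⟩)
      obtain rfl : L' = [] := List.eq_nil_iff_forall_not_mem.2 fun i hi => by simpa using q1 i hi
      refine ⟨0, [], [], lo, q2, hlo, hr, by simp, by simp, .cons ?_ q3 ?_⟩
      · simp [step]
      · simp
    · obtain ⟨b', L', R', q1, q2, q3, q4⟩ := reach_insert (H := H) (pred := pred) v
        (hh x le_rfl ht.le) Q
      refine ⟨b', L', R', lo, q1, hlo, hr, fun i hi => ?_, fun i hi => ?_, q4⟩
      · rcases q2 i hi with hi | rfl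
        · exact hR i hi
        · exact hlo
      · simpa using q3 i hi
  obtain ⟨b, L, R, lo, Q, hlo, hr, hR, hsub, r1⟩ := h1
  obtain ⟨H₂, hr₂, r2⟩ := reach_window (q := zip L b R) (h := h) (pred := pred) v hlo hr
  obtain ⟨b₃, L₃, h₃, Q₃, hs₃, hh₃, r3⟩ := reach_update (H := H₂) (pred := pred) v Q
  obtain ⟨H₄, hr₄, r4⟩ := reach_ready (I := I) (h := h₃) (pot := pot) (pred := pred)
    (tb := tb) (test := .l21) (check := .l22) (body := .l23) (exit := .l24) (b := b₃) (L := L₃)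
    (R := R) (by omega) hr₂ (fun _ _ => rfl) (fun _ _ => rfl) (fun _ _ => rfl) Q₃.pairwise_right
    fun r hr => ⟨hR r hr, (Q₃.right_lt hr).2.2.le⟩
  obtain ⟨b₅, L₅, R₅, H₅, h₅, Q₅, hr₅, hh₅, hs₅, hpen, r5⟩ := reach_penalized (pred := pred) v R
    b₃ L₃ H₄ h₃ Q₃ hr₄
  obtain ⟨b₆, L₆, R₆, h₆, Q₆, hR₆, hh₆, hs₆, hval, r6⟩ := reach_last (pred := pred) v Q₅ hr₅ hpen
  have S : I.Settled (x + 1) ⟨.l38, x + 1, zip L₆ b₆ R₆, H₅, h₆, pot, pred, tb⟩ b₆ L₆ R₆ :=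
    ⟨rfl, rfl, v, rfl, Q₆, fun r hr => hpen r (hR₆.subset hr), hval⟩
  obtain ⟨hb₆, hd₆⟩ := S.minDist_eq (by omega)
  refine ⟨_, b₆, L₆, R₆, ⟨.l2, x + 1, zip L₆ b₆ R₆, H₅, h₆,
    Function.update pot (x + 1) (I.minDist (x + 1)), Function.update pred (x + 1) b₆, tb⟩, S, ?_,
    ?_, ?_, ⟨rfl, rfl, ⟨ht, v.C_eq, v.D_eq, v.P_eq, fun i hi => ?_⟩, ?_, fun i hi hi' => ?_, ?_, ?_⟩,
    rfl, rfl, fun i hi => ?_⟩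
  -- The phases cost 63 and the loop header 1; the bound 99 leaves slack and, with the step out of
  -- `l38`, gives 100 per iteration.
  · refine .cons (s' := ⟨.l3, x + 1, q, H, h, pot, pred, tb⟩) (m := 30 + (10 + (10 + (2 + (1 + 10)))))
      ?_ (r1.trans (r2.trans (r3.trans (r4.trans (r5.trans r6))))) ?_
    · simp [step, ht]
    · simp [State.credit]
  · have : pot b₆ + I.costAt tb b₆ (h₆ b₆) (x + 1) = I.minDist (x + 1) := by
      rw [v.pot_eq b₆ hb₆, v.costAt_eq hb₆ (Q₆.front.h_eq b₆ (by simp)), hd₆]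
    simp [step, this]
  · simp
  · simp only
    rw [Function.update_of_ne (by omega), v.pot_eq i hi]
  · simp
  · change h₆ i = i
    rw [hh₆ i hi, hh₅ i hi, hh₃ i (by omega)]
    exact hh i (by omega) hi'
  · obtain ⟨lo, h1, h2, h3, -⟩ := hr₅
    exact .inr ⟨b₆, L₆, R₆, rfl, Q₆, lo, h1, h2, fun r hr => h3 r (hR₆.subset hr)⟩
  · obtain ⟨lo, h1, h2, -⟩ := hr₅
    exact ⟨lo, h1, h2⟩
  · have h6 : i ∈ (b₃ :: L₃).reverse ++ R := hs₅ i (hs₆ i (by simpa using hi))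
    refine hsub i ?_
    rw [List.mem_append, List.mem_reverse] at h6 ⊢
    exact h6.imp (fun h => hs₃.subset h) id

/-- The computation of the prefix sums. -/
theorem run_pre (m : ℕ) (hm : m ≤ n) : ∃ (h : ℕ → ℕ) (tb : Tables ℝ),
    I.run m = some ⟨.pre, m, ⟨[], none⟩, [], h, fun _ => 0, fun _ => 0, tb⟩ ∧
    (∀ i ≤ m, h i = i) ∧ (∀ i ≤ m, tb.C i = I.tables.C i) ∧ (∀ i ≤ m, tb.D i = I.tables.D i) ∧
    ∀ i ≤ m, tb.P i = I.tables.P i := by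
  induction m with
  | zero => exact ⟨_, _, rfl, by simp, by simp [tables], by simp [tables], by simp [tables]⟩
  | succ m ih =>
    obtain ⟨h, tb, h1, h2, h3, h4, h5⟩ := ih (by omega)
    refine ⟨Function.update h (m + 1) (m + 1),
      ⟨Function.update tb.C (m + 1) (tb.C m + I.c m (m + 1)),
        Function.update tb.D (m + 1) (tb.D m + I.d (m + 1)),
        Function.update tb.P (m + 1) (tb.P m + I.p (m + 1))⟩, ?_, ?_, ?_, ?_, ?_⟩
    · rw [run, h1, Option.bind_some, step]
      simp only
      rw [if_pos (by omega)]
    all_goals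
      intro i hi
      rcases Nat.le_succ_iff.1 hi with hi | rfl
      · have := Nat.ne_of_lt (Nat.lt_succ_of_le hi)
        simp [*]
    · simp
    · simp only [Function.update_self]
      rw [h3 m le_rfl]
      simp [tables, Finset.sum_range_succ]
    · simp only [Function.update_self]
      rw [h4 m le_rfl]
      simp [tables, Finset.sum_Icc_succ_top]
    · simp only [Function.update_self]
      rw [h5 m le_rfl]
      simp [tables, Finset.sum_Icc_succ_top]

/-- The `n + 2` steps are the `n` passes for the prefix sums, the exit from that loop, and the
initialization. The credit is that of the single entry of `queueH`. -/
theorem exists_between_zero : ∃ s, I.run (n + 2) = some s ∧ I.Between 0 s ∧ s.credit = 5 := by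
  obtain ⟨h, tb, h1, h2, h3, h4, h5⟩ := run_pre (I := I) n le_rfl
  refine ⟨⟨.l2, 0, off [], [0], h, fun _ => 0, fun _ => 0, tb⟩, ?_, ⟨rfl, rfl,
    ⟨Nat.zero_le _, h3, h4, h5, by simp⟩, by simp [minDist_zero], fun i _ hi => h2 i hi,
    .inl ⟨rfl, rfl⟩, 0, le_rfl, by simp, fun z => ?_⟩, by simp⟩
  · rw [run, run, h1, Option.bind_some, step]
    simp [step, off]
  · simp only [List.mem_singleton]
    constructor
    · rintro rfl
      exact ⟨le_rfl, le_rfl, fun w h1 h2 => by omega⟩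
    · exact fun h => by omega

theorem Between.credit_nonneg {t : ℕ} {s : State ℝ} (B : I.Between t s) : 0 ≤ s.credit := by
  obtain ⟨line, x, q, H, h, pot, pred, tb⟩ := s
  rcases B.queue with ⟨-, h⟩ | ⟨b, L, R, h, -⟩ <;> simp only at h <;> subst h <;> simp
  positivity

variable (I) in
/-- What iteration `x` has left behind in a later state, after `m` iterations. -/
def Record (m x : ℕ) (s : State ℝ) : Prop :=
  ∃ t r L R, I.AtLine38 t r ∧ I.Settled x r (s.pred x) L R ∧
    (∀ i ∈ s.queue.items, i < x → i ∈ r.queue.items) ∧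
    ∀ z, x ≤ z → z ≤ m → s.pred z < x → s.pred z ∈ r.queue.items

/-- The constant `n + 7` is the `n + 2` initial steps plus the initial credit 5. -/
theorem exists_between (m : ℕ) (hm : m ≤ n) : ∃ t s, I.run t = some s ∧ I.Between m s ∧ n ≤ t ∧
    t + s.credit ≤ n + 7 + 100 * m ∧ ∀ x, 1 ≤ x → x ≤ m → I.Record m x s := by
  induction m with
  | zero =>
    obtain ⟨s, h1, h2, h3⟩ := exists_between_zero (I := I)
    exact ⟨n + 2, s, h1, h2, by omega, by rw [h3]; push_cast; linarith, fun x h1 h2 => by omega⟩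
  | succ m ih =>
    obtain ⟨t, s, h1, h2, h3, h4, h5⟩ := ih (by omega)
    obtain ⟨r, b, L, R, s', S, ⟨k, hk, hc⟩, hs', hc', B, hq, hp, hsub⟩ := reach_iteration h2 hm
    have hrun := hk.run_eq h1
    have hb : b ∈ r.queue.items := by
      rw [S.queue_eq]
      simp
    refine ⟨t + k + 1, s', by rw [run, hrun]; exact hs', B, by omega, ?_, fun x hx hx' => ?_⟩
    · push_cast
      linarith
    rcases Nat.le_succ_iff.1 hx' with hx' | rfl
    · obtain ⟨t₀, r₀, L₀, R₀, q1, q2, q3, q4⟩ := h5 x hx hx'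
      have hne : ∀ z ≤ m, s'.pred z = s.pred z := fun z hz => by
        rw [hp, Function.update_of_ne (by omega)]
      -- An iteration only ever adds its own newest node, so an element below `x` that is present
      -- now was present in iteration `x`.
      have hr : ∀ i ∈ r.queue.items, i < x → i ∈ r₀.queue.items := fun i hi hix => by
        rcases hsub i hi with hi | rfl
        · exact q3 i hi hix
        · omega
      refine ⟨t₀, r₀, L₀, R₀, q1, by rwa [hne x hx'], by rwa [hq], fun z hz hz' hlt => ?_⟩
      rcases Nat.le_succ_iff.1 hz' with hz' | rfl
      · rw [hne z hz'] at hlt ⊢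
        exact q4 z hz hz' hlt
      · have : s'.pred (m + 1) = b := by simp [hp]
        rw [this] at hlt ⊢
        exact hr b hb hlt
    · have hpb : s'.pred (m + 1) = b := by simp [hp]
      refine ⟨t + k, r, L, R, ⟨hrun, S.line_eq⟩, by rwa [hpb], fun i hi _ => by rwa [← hq],
        fun z hz hz' _ => ?_⟩
      obtain rfl : z = m + 1 := le_antisymm hz' hz
      rwa [hpb]

theorem pairwise_getElem? {α : Type*} {r : α → α → Prop} {S : List α} (h : S.Pairwise r) {k : ℕ}
    {a b : α} (ha : S[k]? = some a) (hb : S[k + 1]? = some b) : r a b := by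
  obtain ⟨h1, rfl⟩ := List.getElem?_eq_some_iff.1 ha
  obtain ⟨h2, rfl⟩ := List.getElem?_eq_some_iff.1 hb
  exact List.pairwise_iff_getElem.1 h _ _ h1 h2 (Nat.lt_succ_self k)

theorem Settled.sorted {x : ℕ} {s : State ℝ} {b : ℕ} {L R : List ℕ} (S : I.Settled x s b L R) :
    I.Sorted s.pot s.queue x L.length := by
  -- `Sorted` refers to the exact tables instead of those in memory, which are known to agree only
  -- up to index `n`.
  have v : I.Valid I.tables s.pot x :=
    ⟨S.valid.le, fun _ _ => rfl, fun _ _ => rfl, fun _ _ => rfl, S.valid.pot_eq⟩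
  have hitems : s.queue.items = (b :: L).reverse ++ R := by
    rw [S.queue_eq]
    simp
  have hmem : ∀ {k i : ℕ}, s.queue.items[k]? = some i → i < x := fun h => by
    rw [hitems] at h
    exact S.queue.lt _ (List.mem_of_getElem? h)
  have hinc := S.queue.inc
  rw [← hitems] at hinc
  have hleft : ∀ {k i j : ℕ}, k < L.length → s.queue.items[k]? = some i →
      s.queue.items[k + 1]? = some j → i < j ∧ I.val j x ≤ I.val i x ∧ I.keyP i < I.keyP j :=
    fun {k i j} hk hi hj => by
      rw [hitems, List.getElem?_append_left (by simp; omega)] at hi hj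
      exact pairwise_getElem? (List.pairwise_reverse.2 S.queue.front.chain) hi hj
  have hcur : s.queue.items[L.length]? = some b := by
    rw [hitems, List.getElem?_append_left (by simp)]
    simp
  refine ⟨?_, fun k i j hi hj => (pairwise_getElem? hinc hi hj).1, fun k i j hi hj =>
    (v.dominates_iff (hmem hi) (hmem hj)).2 (pairwise_getElem? hinc hi hj).2, fun k i hk hi => ?_,
    fun i j hi hj => ?_, fun k i hk hi => ?_, fun k i j hk hi hj => ?_, fun k i j hk hi hj => ?_⟩
  · rw [S.queue_eq]
    simp
  · rw [hitems, List.getElem?_append_right (by simp; omega)] at hi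
    exact S.pen_eq_zero i (List.mem_of_getElem? hi)
  · obtain rfl : b = i := Option.some.inj (hcur.symm.trans hi)
    have hj' := hj
    rw [hitems, List.getElem?_append_right (by simp)] at hj'
    rw [v.dominatesA_iff (hmem hi) (hmem hj) rfl rfl]
    refine S.val_lt j ?_
    rw [List.head?_eq_getElem?]
    simpa using hj'
  · rw [hitems, List.reverse_cons, List.append_assoc, List.getElem?_append_left (by simpa)] at hi
    exact S.queue.front.pen_pos i (List.mem_reverse.1 (List.mem_of_getElem? hi))
  · rw [v.dominatesA_iff (hmem hi) (hmem hj) rfl rfl]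
    exact not_lt.2 (hleft hk hi hj).2.1
  · rw [v.dominatesP_iff (hmem hi) (hmem hj)]
    exact (hleft hk hi hj).2.2

end Instance

end SoftVRPSPD

/-! ### Assembly of the result. -/

theorem mainTheorem3 :
    ∃ a b : ℕ, 0 < a ∧ ∀ (n : ℕ) (I : SoftVRPSPD.Instance ℝ n),
      -- each iteration `x = 1, …, n` reaches line 38 exactly once
      (∀ x, 1 ≤ x → x ≤ n → ∃! t, ∃ s, I.AtLine38 t s ∧ s.x = x) ∧
      -- the situation at line 38
      (∀ t s, I.AtLine38 t s →
        1 ≤ s.x ∧ s.x ≤ n ∧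
        (∀ i < s.x, I.IsDist i (s.pot i)) ∧
        (∀ i ∈ s.queue.items, i < s.x) ∧
        -- the seven conditions hold
        (∃ l, I.Sorted s.pot s.queue s.x l) ∧
        -- every removed predecessor is superseded for good by one that is still in the queue
        (∀ i < s.x, i ∉ s.queue.items → ∀ y, s.x ≤ y → y ≤ n →
          ∃ j ∈ s.queue.items, s.pot j + I.arcCost j y ≤ s.pot i + I.arcCost i y) ∧
        -- the cursor points to an optimal predecessor
        (∃ i, s.queue.best? = some i ∧ I.IsOptimalPred i s.x)) ∧
      -- termination in linear time with an optimal split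
      (∃ T s, I.run T = some s ∧ s.line = .done ∧
        (1 ≤ n → a * n ≤ T ∧ T ≤ b * n) ∧
        (∀ x ≤ n, I.IsDist x (s.pot x)) ∧
        (∀ x, 1 ≤ x → x ≤ n → I.IsOptimalPred (s.pred x) x) ∧
        -- `pred` yields a shortest path, and that path has no arc that starts in a node
        -- removed before or in the iteration of the head of the arc
        (∃ ℓ, I.IsShortestPath n ℓ ∧
          (∀ i y, [i, y] <:+: ℓ → s.pred y = i) ∧
          (∀ t r, I.AtLine38 t r → ∀ i < r.x, i ∉ r.queue.items →
            ∀ y, r.x ≤ y → ¬ [i, y] <:+: ℓ))) := by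
  -- The prefix sums alone take `n` steps. Since the final credit is nonnegative, the total is at
  -- most `101 * n + 8`, which is below `120 * n` for `n ≥ 1`.
  refine ⟨1, 120, one_pos, fun n I => ?_⟩
  obtain ⟨t, s, h1, B, hnt, hbound, hrec⟩ := SoftVRPSPD.Instance.exists_between (I := I) n le_rfl
  have hcredit := B.credit_nonneg
  have hat : ∀ t r, I.AtLine38 t r → 1 ≤ r.x ∧ r.x ≤ n ∧ ∃ L R, I.Settled r.x r (s.pred r.x) L R ∧
      (∀ i ∈ s.queue.items, i < r.x → i ∈ r.queue.items) ∧
      ∀ z, r.x ≤ z → z ≤ n → s.pred z < r.x → s.pred z ∈ r.queue.items := fun t r h => by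
    obtain ⟨hx1, hxn⟩ := SoftVRPSPD.Instance.run_range h.1 (by rw [h.2]; rfl)
    obtain ⟨t₀, r₀, L, R, q1, q2, q3⟩ := hrec r.x hx1 hxn
    -- Uniqueness of the visit identifies the given state with the recorded one.
    obtain ⟨-, rfl⟩ := h.eq_of_x_eq q1 q2.x_eq.symm
    exact ⟨hx1, hxn, L, R, q2, q3⟩
  have hpred : ∀ y, 1 ≤ y → y ≤ n →
      s.pred y < y ∧ I.minDist (s.pred y) + I.arcCost (s.pred y) y = I.minDist y :=
    fun y hy hyn => by
      obtain ⟨t₀, r₀, L, R, -, S, -⟩ := hrec y hy hyn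
      exact S.minDist_eq hy
  refine ⟨fun x hx hxn => ?_, fun t r h => ?_, t + 1, { s with line := .done }, ?_, rfl,
    fun hn => ⟨by omega, by zify; linarith [(Nat.cast_le (α := ℤ)).2 hn]⟩,
    fun x hx => ?_, fun x hx hxn => ?_, ?_⟩
  · obtain ⟨t₀, r₀, L, R, q1, S, -⟩ := hrec x hx hxn
    exact ⟨t₀, ⟨r₀, q1, S.x_eq⟩, fun t' ⟨r', h, hx'⟩ =>
      (h.eq_of_x_eq q1 (hx'.trans S.x_eq.symm)).1⟩
  · obtain ⟨hx1, hxn, L, R, S, -⟩ := hat t r h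
    have hitems : r.queue.items = (s.pred r.x :: L).reverse ++ R := by
      rw [S.queue_eq]
      simp
    have hlt : ∀ i ∈ r.queue.items, i < r.x := fun i hi => S.queue.lt i (by rwa [hitems] at hi)
    obtain ⟨hb, he⟩ := S.minDist_eq hx1
    refine ⟨hx1, hxn, fun i hi => ?_, hlt, ⟨_, S.sorted⟩, fun i hi _ y hy hyn => ?_,
      s.pred r.x, by rw [S.queue_eq]; simp, I.isOptimalPred_of_minDist_eq hb he⟩
    · rw [S.valid.pot_eq i hi]
      exact I.isDist_minDist i
    · obtain ⟨j, hj, hs⟩ := S.queue.covers i hi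
      rw [← hitems] at hj
      refine ⟨j, hj, ?_⟩
      have hjx := hlt j hj
      rw [S.valid.pot_eq i hi, S.valid.pot_eq j hjx, I.minDist_add_arcCost (by omega),
        I.minDist_add_arcCost (by omega)]
      linarith [hs y hy hyn]
  · rw [SoftVRPSPD.Instance.run, h1, Option.bind_some, SoftVRPSPD.Instance.step, B.line_eq]
    simp [B.x_eq]
  · have : s.pot x = I.minDist x := by
      rcases hx.lt_or_eq with hx | rfl
      · exact B.valid.pot_eq x hx
      · exact B.pot_eq
    change I.IsDist x (s.pot x)
    rw [this]
    exact I.isDist_minDist x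
  · obtain ⟨hb, he⟩ := hpred x hx hxn
    exact I.isOptimalPred_of_minDist_eq hb he
  · obtain ⟨ℓ, p1, p2, p3⟩ := I.exists_path_of_pred s.pred (fun y hy hyn => (hpred y hy hyn).1)
      (fun y hy hyn => (hpred y hy hyn).2) n le_rfl
    refine ⟨ℓ, I.isShortestPath_of_pathCost_eq p1 p2, fun i y h => (p3 i y h).1,
      fun t r h i hi hni y hy harc => ?_⟩
    obtain ⟨-, -, L, R, -, -, hq⟩ := hat t r h
    obtain ⟨rfl, -, hyn⟩ := p3 i y harc
    -- The tail `s.pred y` was the cursor in iteration `y`; as elements never return, it was already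
    -- in the queue in the earlier or equal iteration `r.x`.
    exact hni (hq y hy hyn hi)
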